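/- Let $N\ge 1$, let $\Omega\subset\mathbb{R}^N$ be a bounded open set with boundary of class $C^2$, let $d(x)=\operatorname{dist}(x,\partial\Omega)$ and $D=\max_{\overline\Omega}d$. Let $\mathbf b\in\mathbb{R}^N$ be a constant vector, let $f:(0,\infty)\to\mathbb{R}$ (a function of time only) belong to $L^\infty(0,T)$ for every $T>0$, and let $$z_0\in\mathbb K_1=\{v\in H_0^1(\Omega):|\nabla v|\le 1\text{ a.e. in }\Omega\},\qquad \mathbb K_\diamond=\{v\in H_0^1(\Omega):-d\le v\le d\text{ a.e. in }\Omega\}.$$ For $\mathbb K=\mathbb K_1$ or $\mathbb K=\mathbb K_\diamond$, a solution of the variational inequality with convex set $\mathbb K$ is a function $z$ on $[0,\infty)\times\overline\Omega$ which, for every $T>0$ and with $Q_T=\Omega\times(0,T)$, belongs to $L^\infty(0,T;W^{1,\infty}_0(\Omega))\cap H^1(0,T;L^2(\Omega))\cap C(\overline{Q_T})$ and satisfies $z(0)=z_0$ and, for a.e. $t\in(0,T)$, $z(t)\in\mathbb K$ and $$\int_\Omega \partial_t z(t)(v-z(t))+\int_\Omega \mathbf b\cdot\nabla z(t)\,(v-z(t))\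 \ge\ \int_\Omega f(t)(v-z(t))\qquad\forall v\in\mathbb K .$$ Theorem 4.3. Assume in addition that (i) for every $t>0$, $\mathbf b\cdot\nabla z_0\le f(t)$ a.e. in $\{x\in\Omega: z_0(x)>-d(x)\}$; (ii) $f$ is nondecreasing and nonnegative on $(0,\infty)$; (iii) $\liminf_{t\to\infty}f(t)>|\mathbf b|+2D$, where the value $+\infty$ of the lower limit is allowed. Then there exists $T_*\in[0,\infty)$ such that every solution $z$ of the variational inequality with convex set $\mathbb K_1$, and likewise every solution $z$ with convex set $\mathbb K_\diamond$, satisfies $$z(x,t)=d(x)\qquad\text{for all }t\ge T_*\text{ and all }x\in\overline\Omega .$$ -/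

import Mathlib

open MeasureTheory Set Filter Topology
open scoped ContDiff

noncomputable section

namespace Sandpile

/-- `ℝ^N` with its Euclidean norm. -/
abbrev Space (N : ℕ) : Type := EuclideanSpace ℝ (Fin N)

/-- The boundary of `Ω` is of class `C²`: near each boundary point, `Ω` is the negativity set of a
`C²` function whose differential does not vanish at that point. -/
def HasC2Boundary {N : ℕ} (Ω : Set (Space N)) : Prop :=
  ∀ x₀ ∈ frontier Ω, ∃ U ∈ 𝓝 x₀, ∃ ρ : Space N → ℝ,
    ContDiff ℝ 2 ρ ∧ fderiv ℝ ρ x₀ ≠ 0 ∧ ∀ x ∈ U, x ∈ Ω ↔ ρ x < 0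

/-- The distance to the boundary of `Ω`. -/
def bdist {N : ℕ} (Ω : Set (Space N)) (x : Space N) : ℝ :=
  Metric.infDist x (frontier Ω)

/-- The number `max_{x ∈ closure Ω} d(x, ∂Ω)`. -/
def maxBdist {N : ℕ} (Ω : Set (Space N)) : ℝ :=
  sSup (bdist Ω '' closure Ω)

/-- `v` belongs to `H¹₀(Ω)` and its weak gradient is `G` (both up to null sets): the pair `(v, G)`
is the limit in `L²(Ω)` of `(φₙ, ∇φₙ)` with test functions `φₙ ∈ C_c^∞(Ω)`. -/
def HasH10Gradient {N : ℕ} (Ω : Set (Space N)) (v : Space N → ℝ) (G : Space N → Space N) : Prop :=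
  MemLp v 2 (volume.restrict Ω) ∧ MemLp G 2 (volume.restrict Ω) ∧
  ∃ φ : ℕ → Space N → ℝ,
    (∀ n, ContDiff ℝ ∞ (φ n) ∧ HasCompactSupport (φ n) ∧ tsupport (φ n) ⊆ Ω) ∧
    Tendsto (fun n => eLpNorm (fun x => φ n x - v x) 2 (volume.restrict Ω)) atTop (𝓝 0) ∧
    Tendsto (fun n => eLpNorm (fun x => gradient (φ n) x - G x) 2 (volume.restrict Ω))
      atTop (𝓝 0)

/-- The convex set `{v ∈ H¹₀(Ω) : |∇v| ≤ 1 a.e. in Ω}`. -/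
def gradientSet {N : ℕ} (Ω : Set (Space N)) : Set (Space N → ℝ) :=
  {v | ∃ G : Space N → Space N, HasH10Gradient Ω v G ∧ ∀ᵐ x ∂volume.restrict Ω, ‖G x‖ ≤ 1}

/-- The convex set `{v ∈ H¹₀(Ω) : -d ≤ v ≤ d a.e. in Ω}`. -/
def obstacleSet {N : ℕ} (Ω : Set (Space N)) : Set (Space N → ℝ) :=
  {v | (∃ G : Space N → Space N, HasH10Gradient Ω v G) ∧
    ∀ᵐ x ∂volume.restrict Ω, -bdist Ω x ≤ v x ∧ v x ≤ bdist Ω x}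

/-- The space-time cylinder `Q_T`, with time as the first coordinate. -/
def cylinder {N : ℕ} (Ω : Set (Space N)) (T : ℝ) : Set (ℝ × Space N) :=
  Ioo 0 T ×ˢ Ω

/-- `p` is the weak (distributional) time derivative of `z` in `Q_T`. -/
def HasWeakTimeDeriv {N : ℕ} (Ω : Set (Space N)) (T : ℝ) (z p : ℝ → Space N → ℝ) : Prop :=
  ∀ φ : ℝ × Space N → ℝ, ContDiff ℝ ∞ φ → HasCompactSupport φ → tsupport φ ⊆ cylinder Ω T →
    ∫ q in cylinder Ω T, z q.1 q.2 * fderiv ℝ φ q (1, 0) =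
      -∫ q in cylinder Ω T, p q.1 q.2 * φ q

/-- `z` solves on `(0, T)` the evolution variational inequality
`∫_Ω ∂ₜz (v - z) + ∫_Ω b·∇z (v - z) ≥ ∫_Ω f (v - z)` for all `v ∈ K`, for a.e. `t`, with
`z(t) ∈ K` and `z(0) = z₀`, in the class
`L^∞(0,T; W₀^{1,∞}(Ω)) ∩ H¹(0,T; L²(Ω)) ∩ C(closure Q_T)`.
Here `p` and `G` are the weak derivatives `∂ₜz` and `∇z`; `z` itself is bounded on `Q_T` because it
is continuous on the compact closure. -/
def SolvesOn {N : ℕ} (Ω : Set (Space N)) (b : Space N) (f : ℝ → ℝ) (z₀ : Space N → ℝ)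
    (K : Set (Space N → ℝ)) (T : ℝ) (z : ℝ → Space N → ℝ) : Prop :=
  ContinuousOn (fun q : ℝ × Space N => z q.1 q.2) (Icc 0 T ×ˢ closure Ω) ∧
  (∀ᵐ x ∂volume.restrict Ω, z 0 x = z₀ x) ∧
  ∃ (p : ℝ → Space N → ℝ) (G : ℝ → Space N → Space N),
    MemLp (fun q : ℝ × Space N => p q.1 q.2) 2 (volume.restrict (cylinder Ω T)) ∧
    HasWeakTimeDeriv Ω T z p ∧
    MemLp (fun q : ℝ × Space N => G q.1 q.2) ⊤ (volume.restrict (cylinder Ω T)) ∧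
    (∀ᵐ t ∂volume.restrict (Ioo 0 T), HasH10Gradient Ω (z t) (G t)) ∧
    (∀ᵐ t ∂volume.restrict (Ioo 0 T), z t ∈ K ∧ ∀ v ∈ K,
      ∫ x in Ω, f t * (v x - z t x) ≤
        (∫ x in Ω, p t x * (v x - z t x)) + ∫ x in Ω, inner ℝ b (G t x) * (v x - z t x))

/-- `z` is a solution global in time: it is a solution on `(0, T)` for each `T > 0`. -/
def Solves {N : ℕ} (Ω : Set (Space N)) (b : Space N) (f : ℝ → ℝ) (z₀ : Space N → ℝ)
    (K : Set (Space N → ℝ)) (z : ℝ → Space N → ℝ) : Prop :=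
  ∀ T : ℝ, 0 < T → SolvesOn Ω b f z₀ K T z

end Sandpile

end

/-!
Both convex sets consist of functions with `|v| ≤ d`, and both are stable under raising an element
`v` to `max (d - c) v` with `c ≥ 0`. Let `f ≥ |b| + δ` on `[s, t]`, where `δ (t - s) = 2D`, put
`c(τ) = 2D - δ (τ - s)`, and test the inequality at time `τ` with `max (d - c(τ)) z(τ)`. The gap
`q = (d - z - c)⁺` then satisfies `∫ q (δ - ∂ₜz) ≤ 0`: since `∫ (b·∇q) q = 0` and `d` is
1-Lipschitz, the transport term costs at most `|b| ∫ q`. As `δ - ∂ₜz` is the time derivative of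
`d - z - c`, the function `τ ↦ ∫ q²` is nonincreasing. It vanishes at `s` because `d - z ≤ 2D`,
hence it vanishes at `t`, where `c = 0`, which means `z(t) ≥ d`.
-/

namespace Sandpile

open scoped NNReal ENNReal Convolution

section Convergence

variable {X : Type*} [MeasurableSpace X] {μ : Measure X}

lemma le_of_ae_restrict_le [TopologicalSpace X] [μ.IsOpenPosMeasure]
    {U : Set X} (hU : IsOpen U) {f g : X → ℝ} (hf : ContinuousOn f U) (hg : ContinuousOn g U)
    (h : ∀ᵐ x ∂μ.restrict U, f x ≤ g x) : ∀ x ∈ U, f x ≤ g x := by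
  have hmax : (fun x => max (f x) (g x)) =ᵐ[μ.restrict U] g :=
    h.mono fun x hx => max_eq_right hx
  exact fun x hx => max_eq_right_iff.1 (Measure.eqOn_open_of_ae_eq hmax hU (hf.sup hg) hg hx)

lemma tendsto_eLpNorm_sub_of_bounded [IsFiniteMeasure μ] {E : Type*} [NormedAddCommGroup E]
    {p : ℝ≥0∞} (hp : 1 ≤ p) (hp' : p ≠ ⊤) {F : ℕ → X → E} {f : X → E} {B : ℝ}
    (hF : ∀ n, AEStronglyMeasurable (F n) μ) (hB : ∀ n x, ‖F n x‖ ≤ B)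
    (hlim : ∀ᵐ x ∂μ, Tendsto (fun n => F n x) atTop (𝓝 (f x))) :
    Tendsto (fun n => eLpNorm (fun x => F n x - f x) p μ) atTop (𝓝 0) := by
  have hf : MemLp f p μ := MemLp.of_bound (aestronglyMeasurable_of_tendsto_ae atTop hF hlim) B <| by
    filter_upwards [hlim] with x hx using le_of_tendsto' hx.norm fun n => hB n x
  refine tendsto_Lp_finite_of_tendsto_ae hp hp' hF hf (unifIntegrable_of hp hp' hF fun ε _ =>
    ⟨Real.toNNReal (B + 1), fun n => ?_⟩) hlim
  have hempty : {x | Real.toNNReal (B + 1) ≤ ‖F n x‖₊} = ∅ := by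
    refine eq_empty_of_forall_notMem fun x hx => ?_
    have := Real.toNNReal_le_iff_le_coe.1 (show Real.toNNReal (B + 1) ≤ ‖F n x‖₊ from hx)
    rw [coe_nnnorm] at this
    linarith [hB n x]
  simp [hempty]

lemma tendsto_eLpNorm_sub_trans {E : Type*} [NormedAddCommGroup E] {p : ℝ≥0∞} (hp : 1 ≤ p)
    {f g : ℕ → X → E} {h : X → E} (hf : ∀ n, AEStronglyMeasurable (f n) μ)
    (hg : ∀ n, AEStronglyMeasurable (g n) μ) (hh : AEStronglyMeasurable h μ)
    (hfg : Tendsto (fun n => eLpNorm (fun x => f n x - g n x) p μ) atTop (𝓝 0))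
    (hgh : Tendsto (fun n => eLpNorm (fun x => g n x - h x) p μ) atTop (𝓝 0)) :
    Tendsto (fun n => eLpNorm (fun x => f n x - h x) p μ) atTop (𝓝 0) := by
  refine tendsto_of_tendsto_of_tendsto_of_le_of_le tendsto_const_nhds
    (by simpa using hfg.add hgh) (fun _ => zero_le) fun n => ?_
  refine (congrArg (eLpNorm · p μ) (funext fun x => ?_)).trans_le
    (eLpNorm_add_le ((hf n).sub (hg n)) ((hg n).sub hh) hp)
  exact (sub_add_sub_cancel _ _ _).symm

lemma tendsto_integral_mul_of_tendsto_eLpNorm {F : ℕ → X → ℝ} {f g : X → ℝ}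
    (hF : ∀ n, MemLp (F n) 2 μ) (hf : MemLp f 2 μ) (hg : MemLp g 2 μ)
    (h : Tendsto (fun n => eLpNorm (fun x => F n x - f x) 2 μ) atTop (𝓝 0)) :
    Tendsto (fun n => ∫ x, F n x * g x ∂μ) atTop (𝓝 (∫ x, f x * g x ∂μ)) := by
  refine tendsto_integral_of_L1' _ (hf.integrable_mul hg).1
    (Eventually.of_forall fun n => (hF n).integrable_mul hg) ?_
  have hlim := ENNReal.Tendsto.mul_const h (Or.inr hg.eLpNorm_ne_top)
  rw [zero_mul] at hlim
  refine tendsto_of_tendsto_of_tendsto_of_le_of_le tendsto_const_nhds hlim (fun _ => zero_le)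
    fun n => ?_
  have hmul : (fun x => F n x * g x) - f * g = (F n - f) • g := by
    ext x
    simp [sub_mul]
  rw [hmul]
  exact eLpNorm_smul_le_mul_eLpNorm (p := 2) (q := 2) (r := 1) hg.1 ((hF n).sub hf).1

end Convergence

section Mollification

variable {E : Type*} [NormedAddCommGroup E]

lemma exists_contDiffBump_seq {δ : ℝ} (hδ : 0 < δ) :
    ∃ φ : ℕ → ContDiffBump (0 : E), (∀ n, (φ n).rOut ≤ δ) ∧
      (∀ n, (φ n).rOut ≤ 2 * (φ n).rIn) ∧ Tendsto (fun n => (φ n).rOut) atTop (𝓝 0) := by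
  refine ⟨fun n => ⟨δ / (n + 1) / 2, δ / (n + 1), by positivity, half_lt_self (by positivity)⟩,
    fun n => div_le_self hδ.le (by simp), fun n => (mul_div_cancel₀ _ two_ne_zero).ge, ?_⟩
  simpa [div_eq_mul_inv] using (tendsto_one_div_add_atTop_nhds_zero_nat (𝕜 := ℝ)).const_mul δ

variable [MeasurableSpace E] {μ : Measure E}

lemma norm_convolution_le {F : Type*} [NormedAddCommGroup F] [NormedSpace ℝ F] {ρ : E → ℝ}
    (hρ : ∀ x, 0 ≤ ρ x) (hρ1 : ∫ x, ρ x ∂μ = 1) {g : E → F} {B : ℝ} (hg : ∀ x, ‖g x‖ ≤ B) (x : E) :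
    ‖(ρ ⋆[ContinuousLinearMap.lsmul ℝ ℝ, μ] g) x‖ ≤ B := by
  calc ‖∫ t, ρ t • g (x - t) ∂μ‖ ≤ ∫ t, ρ t * B ∂μ :=
        norm_integral_le_of_norm_le ((integrable_of_integral_eq_one hρ1).mul_const B) <|
          Eventually.of_forall fun t => by
            rw [norm_smul, Real.norm_of_nonneg (hρ t)]
            exact mul_le_mul_of_nonneg_left (hg _) (hρ t)
    _ = B := by rw [integral_mul_const, hρ1, one_mul]

variable [NormedSpace ℝ E] [FiniteDimensional ℝ E] [BorelSpace E] [μ.IsAddHaarMeasure]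

lemma hasFDerivAt_convolution_of_lipschitz {ρ : E → ℝ} (hρ : Continuous ρ)
    (hρc : HasCompactSupport ρ) {v : E → ℝ} {C : ℝ≥0} (hv : LipschitzWith C v) (x : E) :
    HasFDerivAt (ρ ⋆[ContinuousLinearMap.lsmul ℝ ℝ, μ] v)
      ((ρ ⋆[ContinuousLinearMap.lsmul ℝ ℝ, μ] (fderiv ℝ v)) x) x := by
  have hcont : ∀ y, Continuous fun t => ρ t • v (y - t) := fun y =>
    hρ.smul (hv.continuous.comp (by fun_prop))
  refine (hasFDerivAt_integral_of_dominated_loc_of_lip' (μ := μ) (𝕜 := ℝ)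
    (F := fun x t => ρ t • v (x - t)) (F' := fun t => ρ t • fderiv ℝ v (x - t))
    (bound := fun t => C * ‖ρ t‖) univ_mem (fun y _ => (hcont y).aestronglyMeasurable)
    ((hcont x).integrable_of_hasCompactSupport hρc.smul_right) ?_ ?_
    ((hρ.integrable_of_hasCompactSupport hρc).norm.const_mul _) ?_).2
  · exact hρ.aestronglyMeasurable.smul
      ((measurable_fderiv ℝ v).comp (by fun_prop)).aestronglyMeasurable
  · refine Eventually.of_forall fun t y _ => ?_
    have hlip := hv.norm_sub_le (y - t) (x - t)
    rw [sub_sub_sub_cancel_right] at hlip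
    rw [← smul_sub, norm_smul]
    nlinarith [norm_nonneg (ρ t)]
  · have hdiff := (Measure.measurePreserving_sub_left μ x).quasiMeasurePreserving.ae
      (hv.ae_differentiableAt (μ := μ))
    filter_upwards [hdiff] with t ht
    exact ((hasFDerivAt_comp_sub t).2 ht.hasFDerivAt).const_smul (ρ t)

end Mollification

section SoftThreshold

/-- Soft thresholding at level `ε ≥ 0`: it shortens the distance from `s` to `0` by `ε`, and sends
`[-ε, ε]` to `0`. Composing with it makes the support of a function vanishing on `∂Ω` compact. -/
def softThreshold (ε s : ℝ) : ℝ := s - max (-ε) (min ε s)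

variable {ε s : ℝ}

lemma softThreshold_of_abs_le (h : |s| ≤ ε) : softThreshold ε s = 0 := by
  obtain ⟨h1, h2⟩ := abs_le.1 h
  rw [softThreshold, min_eq_right h2, max_eq_right h1, sub_self]

lemma softThreshold_of_le (hε : 0 ≤ ε) (h : ε ≤ s) : softThreshold ε s = s - ε := by
  rw [softThreshold, min_eq_left h, max_eq_right (by linarith)]

lemma softThreshold_of_le_neg (hε : 0 ≤ ε) (h : s ≤ -ε) : softThreshold ε s = s + ε := by
  rw [softThreshold, min_eq_right (by linarith), max_eq_left h, sub_neg_eq_add]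

lemma abs_softThreshold_sub_le (hε : 0 ≤ ε) (s : ℝ) : |softThreshold ε s - s| ≤ ε := by
  rw [softThreshold, sub_sub_cancel_left, abs_neg]
  exact abs_le.2 ⟨le_max_left _ _, max_le (by linarith) (min_le_left _ _)⟩

lemma lipschitzWith_softThreshold (ε : ℝ) : LipschitzWith 1 (softThreshold ε) := by
  refine LipschitzWith.of_le_add fun s t => ?_
  have hst := abs_le.1 (Real.dist_eq s t).ge
  rw [softThreshold, softThreshold]
  rcases max_cases (-ε) (min ε s) with h | h <;> rcases max_cases (-ε) (min ε t) with h' | h' <;>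
    rcases min_cases ε s with k | k <;> rcases min_cases ε t with k' | k' <;> linarith

lemma abs_softThreshold_le (hε : 0 ≤ ε) (s : ℝ) : |softThreshold ε s| ≤ |s| := by
  have h0 : softThreshold ε 0 = 0 := softThreshold_of_abs_le (by rwa [abs_zero])
  simpa [h0] using (lipschitzWith_softThreshold ε).norm_sub_le s 0

variable {F : Type*} [NormedAddCommGroup F] [InnerProductSpace ℝ F] [CompleteSpace F]

lemma eventually_gradient_softThreshold_comp {u : F → ℝ} {x : F} (hu : ContinuousAt u x) :
    ∀ᶠ ε in 𝓝[>] 0,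
      gradient (softThreshold ε ∘ u) x = {x | u x ≠ 0}.indicator (gradient u) x := by
  by_cases hx : u x = 0
  · filter_upwards [self_mem_nhdsWithin] with ε hε
    have hloc : softThreshold ε ∘ u =ᶠ[𝓝 x] fun _ => 0 := by
      filter_upwards [hu.abs.eventually_lt_const (by simpa [hx] using hε)] with y hy
      exact softThreshold_of_abs_le hy.le
    rw [hloc.gradient_eq, gradient_fun_const, indicator_of_notMem (by simpa using hx)]
  · filter_upwards [self_mem_nhdsWithin,
      nhdsWithin_le_nhds (eventually_lt_nhds (abs_pos.2 hx))] with ε hε hεx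
    obtain ⟨c, hc⟩ : ∃ c, softThreshold ε ∘ u =ᶠ[𝓝 x] fun y => u y + c := by
      rcases lt_abs.1 hεx with hpos | hneg
      · exact ⟨-ε, (hu.eventually_const_lt hpos).mono fun y hy => softThreshold_of_le hε.le hy.le⟩
      · exact ⟨ε, (hu.eventually_lt_const (lt_neg.1 hneg)).mono fun y hy =>
          softThreshold_of_le_neg hε.le hy.le⟩
    rw [hc.gradient_eq, indicator_of_mem (by simpa using hx), gradient, gradient, fderiv_add_const]

end SoftThreshold

section Gradient

variable {F : Type*} [NormedAddCommGroup F] [InnerProductSpace ℝ F] [CompleteSpace F]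

lemma norm_gradient_sub (φ ψ : F → ℝ) (x : F) :
    ‖gradient φ x - gradient ψ x‖ = ‖fderiv ℝ φ x - fderiv ℝ ψ x‖ := by
  rw [gradient, gradient, ← map_sub, LinearIsometryEquiv.norm_map]

lemma norm_gradient_le_of_lipschitz {u : F → ℝ} {C : ℝ≥0} (hu : LipschitzWith C u) (x : F) :
    ‖gradient u x‖ ≤ C := by
  rw [gradient, LinearIsometryEquiv.norm_map]
  exact norm_fderiv_le_of_lipschitz ℝ hu

lemma measurable_gradient [MeasurableSpace F] [BorelSpace F] (u : F → ℝ) :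
    Measurable (gradient u) :=
  (InnerProductSpace.toDual ℝ F).symm.continuous.measurable.comp (measurable_fderiv ℝ u)

end Gradient

variable {N : ℕ} {Ω : Set (Space N)}

section HasH10Gradient

/-- The test functions of class `C_c^∞(Ω)`. -/
def IsTestFunction (Ω : Set (Space N)) (φ : Space N → ℝ) : Prop :=
  ContDiff ℝ ∞ φ ∧ HasCompactSupport φ ∧ tsupport φ ⊆ Ω

lemma HasH10Gradient.of_tendsto {v : Space N → ℝ} {G : Space N → Space N}
    (hv : MemLp v 2 (volume.restrict Ω)) (hG : MemLp G 2 (volume.restrict Ω))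
    {w : ℕ → Space N → ℝ} {H : ℕ → Space N → Space N} (h : ∀ n, HasH10Gradient Ω (w n) (H n))
    (hw : Tendsto (fun n => eLpNorm (fun x => w n x - v x) 2 (volume.restrict Ω)) atTop (𝓝 0))
    (hH : Tendsto (fun n => eLpNorm (fun x => H n x - G x) 2 (volume.restrict Ω)) atTop (𝓝 0)) :
    HasH10Gradient Ω v G := by
  have hnear : ∀ n : ℕ, ∃ φ : Space N → ℝ, IsTestFunction Ω φ ∧
      eLpNorm (fun x => φ x - w n x) 2 (volume.restrict Ω) < (n : ℝ≥0∞)⁻¹ ∧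
      eLpNorm (fun x => gradient φ x - H n x) 2 (volume.restrict Ω) < (n : ℝ≥0∞)⁻¹ := fun n => by
    obtain ⟨-, -, φ, hφ, hφw, hφH⟩ := h n
    have hpos : 0 < (n : ℝ≥0∞)⁻¹ := ENNReal.inv_pos.2 (ENNReal.natCast_ne_top n)
    obtain ⟨k, hk⟩ := ((hφw.eventually_lt_const hpos).and (hφH.eventually_lt_const hpos)).exists
    exact ⟨φ k, hφ k, hk⟩
  choose φ hφ hφw hφH using hnear
  have hlim : ∀ {δ : ℕ → ℝ≥0∞}, (∀ n, δ n < (n : ℝ≥0∞)⁻¹) → Tendsto δ atTop (𝓝 0) := fun hδ =>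
    tendsto_of_tendsto_of_tendsto_of_le_of_le tendsto_const_nhds
      ENNReal.tendsto_inv_nat_nhds_zero (fun _ => zero_le) fun n => (hδ n).le
  exact ⟨hv, hG, φ, hφ,
    tendsto_eLpNorm_sub_trans one_le_two (fun n => (hφ n).1.continuous.aestronglyMeasurable)
      (fun n => (h n).1.1) hv.1 (hlim hφw) hw,
    tendsto_eLpNorm_sub_trans one_le_two (fun n => (measurable_gradient _).aestronglyMeasurable)
      (fun n => (h n).2.1.1) hG.1 (hlim hφH) hH⟩

lemma isTestFunction_convolution {v : Space N → ℝ} (hv : Continuous v)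
    (hvc : HasCompactSupport v) {δ : ℝ} (hδ : Metric.cthickening δ (tsupport v) ⊆ Ω)
    (φ : ContDiffBump (0 : Space N)) (hφ : φ.rOut ≤ δ) :
    IsTestFunction Ω (φ.normed volume ⋆[ContinuousLinearMap.lsmul ℝ ℝ, volume] v) := by
  have hsupp : tsupport (φ.normed volume ⋆[ContinuousLinearMap.lsmul ℝ ℝ, volume] v) ⊆
      Metric.cthickening δ (tsupport v) := by
    refine closure_minimal (fun x hx => ?_) Metric.isClosed_cthickening
    obtain ⟨y, hy, w, hw, rfl⟩ := support_convolution_subset _ hx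
    rw [φ.support_normed_eq, mem_ball_zero_iff] at hy
    refine Metric.mem_cthickening_of_dist_le _ w _ _ (subset_tsupport _ hw) ?_
    rw [dist_eq_norm, add_sub_cancel_right]
    exact hy.le.trans hφ
  exact ⟨φ.hasCompactSupport_normed.contDiff_convolution_left _ φ.contDiff_normed
      hv.locallyIntegrable, HasCompactSupport.of_support_subset_isCompact
      hvc.isCompact.cthickening ((subset_tsupport _).trans hsupp), hsupp.trans hδ⟩

lemma hasH10Gradient_gradient_of_lipschitz (hΩ : IsOpen Ω) (hΩfin : volume Ω ≠ ⊤)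
    {v : Space N → ℝ} {C : ℝ≥0} (hv : LipschitzWith C v) (hvc : HasCompactSupport v)
    (hvΩ : tsupport v ⊆ Ω) :
    HasH10Gradient Ω v (gradient v) := by
  have := isFiniteMeasure_restrict.2 hΩfin
  obtain ⟨δ, hδ, hδΩ⟩ := hvc.isCompact.exists_cthickening_subset_open hΩ hvΩ
  obtain ⟨φ, hφδ, hφin, hφ0⟩ := exists_contDiffBump_seq (E := Space N) hδ
  obtain ⟨B, hB⟩ := hvc.exists_bound_of_continuous hv.continuous
  have hfderiv : ∀ x, ‖fderiv ℝ v x‖ ≤ C := fun x => norm_fderiv_le_of_lipschitz ℝ hv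
  have hloc : LocallyIntegrable (fderiv ℝ v) volume :=
    (locallyIntegrable_const (C : ℝ)).mono (measurable_fderiv ℝ v).aestronglyMeasurable
      (Eventually.of_forall fun x => (hfderiv x).trans (Real.le_norm_self _))
  have hgrad : ∀ n x, fderiv ℝ ((φ n).normed volume ⋆[ContinuousLinearMap.lsmul ℝ ℝ, volume] v) x =
      ((φ n).normed volume ⋆[ContinuousLinearMap.lsmul ℝ ℝ, volume] (fderiv ℝ v)) x := fun n x =>
    (hasFDerivAt_convolution_of_lipschitz (φ n).continuous_normed
      (φ n).hasCompactSupport_normed hv x).fderiv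
  have htest := fun n => isTestFunction_convolution hv.continuous hvc hδΩ (φ n) (hφδ n)
  refine ⟨MemLp.of_bound hv.continuous.aestronglyMeasurable B (Eventually.of_forall hB),
    MemLp.of_bound (measurable_gradient v).aestronglyMeasurable C
      (Eventually.of_forall (norm_gradient_le_of_lipschitz hv)), _, htest, ?_, ?_⟩
  · exact tendsto_eLpNorm_sub_of_bounded one_le_two ENNReal.ofNat_ne_top
      (fun n => (htest n).1.continuous.aestronglyMeasurable)
      (fun n => norm_convolution_le (φ n).nonneg_normed (φ n).integral_normed hB)
      (ae_restrict_of_ae (ContDiffBump.ae_convolution_tendsto_right_of_locallyIntegrable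
        hφ0 (Eventually.of_forall hφin) hv.continuous.locallyIntegrable))
  · have hlim := tendsto_eLpNorm_sub_of_bounded (p := 2) one_le_two ENNReal.ofNat_ne_top
      (fun n => ((measurable_fderiv ℝ _).aestronglyMeasurable.congr
        (Eventually.of_forall (hgrad n)) : AEStronglyMeasurable _ (volume.restrict Ω)))
      (fun n => norm_convolution_le (φ n).nonneg_normed (φ n).integral_normed hfderiv)
      (ae_restrict_of_ae (ContDiffBump.ae_convolution_tendsto_right_of_locallyIntegrable
        hφ0 (Eventually.of_forall hφin) hloc))
    refine hlim.congr fun n => eLpNorm_congr_norm_ae (Eventually.of_forall fun x => ?_)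
    rw [norm_gradient_sub, hgrad]

lemma exists_hasH10Gradient_of_lipschitz (hΩ : IsOpen Ω) (hb : Bornology.IsBounded Ω)
    {u : Space N → ℝ} {C : ℝ≥0} (hu : LipschitzWith C u) (hu0 : ∀ x ∉ Ω, u x = 0) :
    ∃ G : Space N → Space N, HasH10Gradient Ω u G ∧ ∀ x, ‖G x‖ ≤ C := by
  have hΩfin := hb.measure_lt_top (μ := volume).ne
  have := isFiniteMeasure_restrict.2 hΩfin
  -- The gradients of the thresholded functions converge everywhere to this cut-off of `∇u`.
  have hGb : ∀ x, ‖{x | u x ≠ 0}.indicator (gradient u) x‖ ≤ C := fun x =>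
    (norm_indicator_le_norm_self _ _).trans (norm_gradient_le_of_lipschitz hu x)
  have hGm : Measurable ({x | u x ≠ 0}.indicator (gradient u)) :=
    (measurable_gradient u).indicator (hu.continuous.measurable (measurableSet_singleton 0).compl)
  have huc : HasCompactSupport u := HasCompactSupport.of_support_subset_isCompact
    hb.isCompact_closure fun x hx => subset_closure (not_imp_comm.1 (hu0 x) hx)
  obtain ⟨B, hB⟩ := huc.exists_bound_of_continuous hu.continuous
  obtain ⟨ε, -, hε, hε0⟩ := exists_seq_strictAnti_tendsto (0 : ℝ)
  have hεpos : Tendsto ε atTop (𝓝[>] 0) :=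
    tendsto_nhdsWithin_iff.2 ⟨hε0, Eventually.of_forall hε⟩
  have hv : ∀ n, LipschitzWith C (softThreshold (ε n) ∘ u) := fun n => by
    simpa only [one_mul] using (lipschitzWith_softThreshold (ε n)).comp hu
  have hvΩ : ∀ n, tsupport (softThreshold (ε n) ∘ u) ⊆ Ω := fun n x hx => by
    have hsub : Function.support (softThreshold (ε n) ∘ u) ⊆ {y | ε n ≤ |u y|} :=
      fun y hy => not_lt.1 fun h => hy (softThreshold_of_abs_le h.le)
    have hεx : ε n ≤ |u x| :=
      closure_minimal hsub (isClosed_le continuous_const hu.continuous.abs) hx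
    exact not_imp_comm.1 (hu0 x) (abs_pos.1 ((hε n).trans_le hεx))
  have hvc : ∀ n, HasCompactSupport (softThreshold (ε n) ∘ u) := fun n =>
    huc.comp_left (softThreshold_of_abs_le (by simpa using (hε n).le))
  refine ⟨_, HasH10Gradient.of_tendsto
    (MemLp.of_bound hu.continuous.aestronglyMeasurable B (Eventually.of_forall hB))
    (MemLp.of_bound hGm.aestronglyMeasurable C (Eventually.of_forall hGb))
    (fun n => hasH10Gradient_gradient_of_lipschitz hΩ hΩfin (hv n) (hvc n) (hvΩ n)) ?_ ?_, hGb⟩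
  · refine tendsto_eLpNorm_sub_of_bounded (B := B) one_le_two ENNReal.ofNat_ne_top
      (fun n => (hv n).continuous.aestronglyMeasurable)
      (fun n x => (abs_softThreshold_le (hε n).le _).trans (hB x))
      (Eventually.of_forall fun x => ?_)
    exact tendsto_iff_norm_sub_tendsto_zero.2 (squeeze_zero (fun n => norm_nonneg _)
      (fun n => abs_softThreshold_sub_le (hε n).le _) hε0)
  · exact tendsto_eLpNorm_sub_of_bounded one_le_two ENNReal.ofNat_ne_top
      (fun n => (measurable_gradient _).aestronglyMeasurable)
      (fun n => norm_gradient_le_of_lipschitz (hv n)) (Eventually.of_forall fun x =>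
        (tendsto_nhds_of_eventually_eq (hεpos.eventually
          (eventually_gradient_softThreshold_comp hu.continuous.continuousAt))))

end HasH10Gradient

section IntegrationByParts

lemma IsTestFunction.exists_lipschitzWith {φ : Space N → ℝ} (hφ : IsTestFunction Ω φ) :
    ∃ C, LipschitzWith C φ :=
  hφ.1.lipschitzWith_of_hasCompactSupport hφ.2.1 (by simp)

lemma IsTestFunction.setIntegral_inner_gradient_mul {φ q : Space N → ℝ}
    (hφ : IsTestFunction Ω φ) {C : ℝ≥0} (hq : LipschitzWith C q) (b : Space N) :
    ∫ x in Ω, inner ℝ b (gradient φ x) * q x = ∫ x in Ω, φ x * lineDeriv ℝ q x (-b) := by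
  obtain ⟨Cφ, hCφ⟩ := hφ.exists_lipschitzWith
  have hzero : ∀ x ∉ Ω, φ x = 0 := fun x hx =>
    image_eq_zero_of_notMem_tsupport fun h => hx (hφ.2.2 h)
  have hzero' : ∀ x ∉ Ω, gradient φ x = 0 := fun x hx => by
    rw [(notMem_tsupport_iff_eventuallyEq.1 fun h => hx (hφ.2.2 h)).gradient_eq]
    exact gradient_const x 0
  rw [setIntegral_eq_integral_of_forall_compl_eq_zero fun x hx => by simp [hzero' x hx],
    setIntegral_eq_integral_of_forall_compl_eq_zero fun x hx => by simp [hzero x hx]]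
  calc ∫ x, inner ℝ b (gradient φ x) * q x = ∫ x, lineDeriv ℝ φ x b * q x := by
        simp_rw [inner_gradient_right,
          fun x => (hφ.1.differentiable (by simp) x).lineDeriv_eq_fderiv (v := b), conj_trivial]
    _ = ∫ x, φ x * lineDeriv ℝ q x (-b) := by
        simpa only [neg_neg, mul_comm (φ _)] using
          (hq.integral_lineDeriv_mul_eq (μ := volume) hCφ hφ.2.1 (-b)).symm

lemma HasH10Gradient.setIntegral_inner_mul_eq (hΩ : volume Ω ≠ ⊤) {v : Space N → ℝ}
    {G : Space N → Space N} (h : HasH10Gradient Ω v G) (b : Space N) {q : Space N → ℝ} {C : ℝ≥0}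
    (hq : LipschitzWith C q) (hqc : HasCompactSupport q) :
    ∫ x in Ω, inner ℝ b (G x) * q x = ∫ x in Ω, v x * lineDeriv ℝ q x (-b) := by
  have := isFiniteMeasure_restrict.2 hΩ
  obtain ⟨hv, hG, φ, hφ, hφv, hφG⟩ := h
  have hlineDeriv : MemLp (fun x => lineDeriv ℝ q x (-b)) 2 (volume.restrict Ω) :=
    MemLp.of_bound (measurable_lineDeriv hq.continuous).aestronglyMeasurable (C * ‖-b‖)
      (Eventually.of_forall fun x => norm_lineDeriv_le_of_lipschitz ℝ hq)
  have hφG' : ∀ n, MemLp (gradient (φ n)) 2 (volume.restrict Ω) := fun n => by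
    obtain ⟨Cφ, hCφ⟩ := IsTestFunction.exists_lipschitzWith (hφ n)
    exact MemLp.of_bound (measurable_gradient _).aestronglyMeasurable Cφ
      (Eventually.of_forall (norm_gradient_le_of_lipschitz hCφ))
  have hinner : Tendsto (fun n => eLpNorm
      (fun x => inner ℝ b (gradient (φ n) x) - inner ℝ b (G x)) 2 (volume.restrict Ω))
      atTop (𝓝 0) := by
    have hlim := ENNReal.Tendsto.const_mul hφG (Or.inr (ENNReal.coe_ne_top (r := ‖b‖₊)))
    rw [mul_zero] at hlim
    refine tendsto_of_tendsto_of_tendsto_of_le_of_le tendsto_const_nhds hlim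
      (fun _ => zero_le) fun n => eLpNorm_le_nnreal_smul_eLpNorm_of_ae_le_mul
        (Eventually.of_forall fun x => ?_) 2
    rw [← inner_sub_right]
    exact nnnorm_inner_le_nnnorm b _
  refine tendsto_nhds_unique (tendsto_integral_mul_of_tendsto_eLpNorm
    (fun n => (hφG' n).const_inner b) (hG.const_inner b)
    (hq.continuous.memLp_of_hasCompactSupport hqc) hinner) ?_
  refine (tendsto_integral_mul_of_tendsto_eLpNorm (fun n =>
    (hφ n).1.continuous.memLp_of_hasCompactSupport (hφ n).2.1) hv hlineDeriv hφv).congr fun n => ?_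
  exact (IsTestFunction.setIntegral_inner_gradient_mul (hφ n) hq b).symm

end IntegrationByParts

section Lipschitz

lemma HasH10Gradient.locallyIntegrable_indicator {v : Space N → ℝ} {G : Space N → Space N}
    (h : HasH10Gradient Ω v G) (hΩ : MeasurableSet Ω) (hΩfin : volume Ω ≠ ⊤) :
    LocallyIntegrable (Ω.indicator v) volume := by
  have := isFiniteMeasure_restrict.2 hΩfin
  exact ((integrable_indicator_iff hΩ).2 (h.1.integrable one_le_two)).locallyIntegrable

lemma HasH10Gradient.fderiv_convolution_apply {v : Space N → ℝ} {G : Space N → Space N}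
    (h : HasH10Gradient Ω v G) (hΩ : MeasurableSet Ω) (hΩfin : volume Ω ≠ ⊤) {ρ : Space N → ℝ}
    (hρ : ContDiff ℝ 1 ρ) (hρc : HasCompactSupport ρ) (x e : Space N) :
    fderiv ℝ (ρ ⋆[ContinuousLinearMap.lsmul ℝ ℝ, volume] Ω.indicator v) x e =
      ∫ y in Ω, inner ℝ e (G y) * ρ (x - y) := by
  have hloc : LocallyIntegrable (Ω.indicator v) volume :=
    h.locallyIntegrable_indicator hΩ hΩfin
  obtain ⟨C, hC⟩ := hρ.lipschitzWith_of_hasCompactSupport hρc one_ne_zero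
  have hq : LipschitzWith C fun y => ρ (x - y) := by
    simpa only [mul_one] using! hC.comp (IsometryEquiv.subLeft x).isometry.lipschitz
  have hlineDeriv : ∀ y, lineDeriv ℝ (fun y => ρ (x - y)) y (-e) = fderiv ℝ ρ (x - y) e :=
    fun y => by
      have hd := ((hρ.differentiable one_ne_zero (x - y)).hasFDerivAt.comp y
        ((hasFDerivAt_id y).const_sub x)).hasLineDerivAt (-e)
      simpa using! hd.lineDeriv
  calc fderiv ℝ (ρ ⋆[ContinuousLinearMap.lsmul ℝ ℝ, volume] Ω.indicator v) x e
      = ∫ y, fderiv ℝ ρ (x - y) e • Ω.indicator v y := by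
        rw [← convolution_flip, (hρc.hasFDerivAt_convolution_right _ hloc hρ x).fderiv,
          convolution_precompR_apply _ hloc (hρc.fderiv ℝ) (hρ.continuous_fderiv one_ne_zero),
          convolution_def]
        rfl
    _ = ∫ y in Ω, v y * lineDeriv ℝ (fun y => ρ (x - y)) y (-e) := by
        rw [← integral_indicator hΩ]
        congr 1 with y
        by_cases hy : y ∈ Ω <;> simp [hy, hlineDeriv, mul_comm]
    _ = _ := (h.setIntegral_inner_mul_eq hΩfin e hq
        (hρc.comp_homeomorph (Homeomorph.subLeft x))).symm

lemma HasH10Gradient.lipschitzWith_convolution {v : Space N → ℝ} {G : Space N → Space N}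
    (h : HasH10Gradient Ω v G) (hΩ : MeasurableSet Ω) (hΩfin : volume Ω ≠ ⊤) {M : ℝ≥0}
    (hM : ∀ᵐ x ∂volume.restrict Ω, ‖G x‖ ≤ M) {ρ : Space N → ℝ} (hρ : ContDiff ℝ 1 ρ)
    (hρc : HasCompactSupport ρ) (hρ0 : ∀ x, 0 ≤ ρ x) (hρ1 : ∫ x, ρ x = 1) :
    LipschitzWith M (ρ ⋆[ContinuousLinearMap.lsmul ℝ ℝ, volume] Ω.indicator v) := by
  have hdiff : Differentiable ℝ (ρ ⋆[ContinuousLinearMap.lsmul ℝ ℝ, volume] Ω.indicator v) :=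
    (hρc.contDiff_convolution_left _ hρ
      (h.locallyIntegrable_indicator hΩ hΩfin)).differentiable one_ne_zero
  refine lipschitzWith_of_nnnorm_fderiv_le hdiff fun x =>
    ContinuousLinearMap.opNorm_le_bound _ M.2 fun e => ?_
  have hint : Integrable (fun y => ρ (x - y)) :=
    (integrable_of_integral_eq_one hρ1).comp_sub_left x
  rw [h.fderiv_convolution_apply hΩ hΩfin hρ hρc]
  calc ‖∫ y in Ω, inner ℝ e (G y) * ρ (x - y)‖
      ≤ ∫ y in Ω, M * ‖e‖ * ρ (x - y) := by
        refine norm_integral_le_of_norm_le (hint.integrableOn.const_mul _) ?_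
        filter_upwards [hM] with y hy
        rw [norm_mul, Real.norm_of_nonneg (hρ0 _), mul_comm (M : ℝ)]
        gcongr
        exacts [hρ0 _, (norm_inner_le_norm _ _).trans (by gcongr)]
    _ ≤ ∫ y, M * ‖e‖ * ρ (x - y) :=
        setIntegral_le_integral (hint.const_mul _)
          (Eventually.of_forall fun y => mul_nonneg (by positivity) (hρ0 _))
    _ = M * ‖e‖ := by rw [integral_const_mul, integral_sub_left_eq_self ρ, hρ1, mul_one]

lemma HasH10Gradient.lipschitzOnWith {v : Space N → ℝ} {G : Space N → Space N}
    (h : HasH10Gradient Ω v G) (hΩ : IsOpen Ω) (hΩfin : volume Ω ≠ ⊤)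
    (hv : ContinuousOn v Ω) {M : ℝ≥0} (hM : ∀ᵐ x ∂volume.restrict Ω, ‖G x‖ ≤ M) :
    LipschitzOnWith M (Ω.indicator v) (Ω ∪ (closure Ω)ᶜ) := by
  obtain ⟨φ, -, -, hφ⟩ := exists_contDiffBump_seq (E := Space N) one_pos
  have hcont : ∀ x ∈ Ω ∪ (closure Ω)ᶜ, ContinuousAt (Ω.indicator v) x := by
    rintro x (hx | hx)
    · refine (hv.continuousAt (hΩ.mem_nhds hx)).congr ?_
      filter_upwards [hΩ.mem_nhds hx] with y hy using (indicator_of_mem hy v).symm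
    · refine (continuousAt_const (y := (0 : ℝ))).congr ?_
      filter_upwards [isClosed_closure.isOpen_compl.mem_nhds hx] with y hy
        using (indicator_of_notMem (fun h => hy (subset_closure h)) v).symm
  have hlim : ∀ x ∈ Ω ∪ (closure Ω)ᶜ, Tendsto (fun n => ((φ n).normed volume
      ⋆[ContinuousLinearMap.lsmul ℝ ℝ, volume] Ω.indicator v) x) atTop
      (𝓝 (Ω.indicator v x)) := fun x hx =>
    ContDiffBump.convolution_tendsto_right hφ (Eventually.of_forall fun _ =>
      (h.locallyIntegrable_indicator hΩ.measurableSet hΩfin).aestronglyMeasurable)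
      ((hcont x hx).tendsto.comp tendsto_snd) tendsto_const_nhds
  refine LipschitzOnWith.of_dist_le_mul fun x hx y hy => ?_
  exact le_of_tendsto' ((hlim x hx).dist (hlim y hy)) fun n =>
    (h.lipschitzWith_convolution hΩ.measurableSet hΩfin hM (φ n).contDiff_normed
      (φ n).hasCompactSupport_normed (φ n).nonneg_normed (φ n).integral_normed).dist_le_mul x y

lemma HasH10Gradient.lipschitzWith {v : Space N → ℝ} {G : Space N → Space N}
    (h : HasH10Gradient Ω v G) (hΩ : interior (closure Ω) = Ω) (hΩfin : volume Ω ≠ ⊤)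
    (hv : ContinuousOn v Ω) {M : ℝ≥0} (hM : ∀ᵐ x ∂volume.restrict Ω, ‖G x‖ ≤ M) :
    LipschitzWith M (Ω.indicator v) := by
  have hlip := h.lipschitzOnWith (hΩ ▸ isOpen_interior) hΩfin hv hM
  have hexterior : closure (closure Ω)ᶜ = Ωᶜ := by rw [closure_compl, hΩ]
  have hmixed : ∀ x ∈ Ω, ∀ y ∉ Ω, dist (Ω.indicator v x) 0 ≤ M * dist x y := fun x hx y hy => by
    have hclosed : IsClosed {y | dist (Ω.indicator v x) 0 ≤ M * dist x y} :=
      isClosed_le continuous_const (by fun_prop)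
    refine closure_minimal (s := (closure Ω)ᶜ) (fun z hz => ?_) hclosed (hexterior ▸ hy)
    simpa [indicator_of_notMem (fun hzΩ => hz (subset_closure hzΩ))] using
      hlip.dist_le_mul x (Or.inl hx) z (Or.inr hz)
  refine LipschitzWith.of_dist_le_mul fun x y => ?_
  by_cases hx : x ∈ Ω <;> by_cases hy : y ∈ Ω
  · exact hlip.dist_le_mul x (Or.inl hx) y (Or.inl hy)
  · simpa only [indicator_of_notMem hy] using hmixed x hx y hy
  · simpa only [indicator_of_notMem hx, dist_comm] using hmixed y hy x hx
  · simp only [indicator_of_notMem hx, indicator_of_notMem hy, dist_self]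
    positivity

end Lipschitz

section Transport

variable {E : Type*} [NormedAddCommGroup E] [NormedSpace ℝ E]

lemma lineDeriv_posPart_mul_posPart {w : E → ℝ} {x : E} (hw : ContinuousAt w x) (b : E) :
    lineDeriv ℝ (fun y => max (w y) 0) x b * max (w x) 0 = lineDeriv ℝ w x b * max (w x) 0 := by
  rcases le_or_gt (w x) 0 with h | h
  · rw [max_eq_right h, mul_zero, mul_zero]
  · have hloc : (fun y => max (w y) 0) =ᶠ[𝓝 x] w :=
      (hw.eventually_const_lt h).mono fun y hy => max_eq_left hy.le
    rw [hloc.lineDeriv_eq]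

variable [MeasurableSpace E] [BorelSpace E] {μ : Measure E} {w q : E → ℝ} {C : ℝ≥0}

lemma integrable_lineDeriv_mul [IsFiniteMeasureOnCompacts μ] (hw : LipschitzWith C w)
    (hq : Continuous q) (hqc : HasCompactSupport q) (b : E) :
    Integrable (fun x => lineDeriv ℝ w x b * q x) μ :=
  (hq.integrable_of_hasCompactSupport hqc).bdd_mul
    (measurable_lineDeriv hw.continuous).aestronglyMeasurable
    (Eventually.of_forall fun _ => norm_lineDeriv_le_of_lipschitz ℝ hw)

variable [FiniteDimensional ℝ E] [μ.IsAddHaarMeasure]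

lemma integral_lineDeriv_mul_self (hq : LipschitzWith C q) (hqc : HasCompactSupport q) (b : E) :
    ∫ x, lineDeriv ℝ q x b * q x ∂μ = 0 := by
  have h := hq.integral_lineDeriv_mul_eq (μ := μ) hq hqc b
  simp only [lineDeriv_neg, neg_mul, integral_neg] at h
  linarith

lemma integral_lineDeriv_mul_posPart (hw : LipschitzWith C w)
    (hwc : HasCompactSupport fun x => max (w x) 0) (b : E) :
    ∫ x, lineDeriv ℝ w x b * max (w x) 0 ∂μ = 0 := by
  simp_rw [← lineDeriv_posPart_mul_posPart hw.continuous.continuousAt]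
  exact integral_lineDeriv_mul_self (hw.max_const 0) hwc b

lemma integral_lineDeriv_mul_posPart_sub_le {u g : E → ℝ} {L : ℝ≥0} (hu : LipschitzWith C u)
    (hg : LipschitzWith L g) (c : ℝ) (hc : HasCompactSupport fun x => max (g x - u x - c) 0)
    (b : E) :
    ∫ x, lineDeriv ℝ u x b * max (g x - u x - c) 0 ∂μ ≤
      L * ‖b‖ * ∫ x, max (g x - u x - c) 0 ∂μ := by
  have hw : LipschitzWith (L + C) fun x => g x - u x - c := by
    simpa using (hg.sub hu).sub (LipschitzWith.const c)
  have hcont : Continuous fun x => max (g x - u x - c) 0 := hw.continuous.max continuous_const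
  have hsplit : ∀ᵐ x ∂μ, lineDeriv ℝ u x b * max (g x - u x - c) 0 =
      lineDeriv ℝ g x b * max (g x - u x - c) 0 -
        lineDeriv ℝ (fun x => g x - u x - c) x b * max (g x - u x - c) 0 := by
    filter_upwards [hu.ae_lineDifferentiableAt b, hg.ae_lineDifferentiableAt b] with x hux hgx
    have hwx : HasLineDerivAt ℝ (fun x => g x - u x - c)
        (lineDeriv ℝ g x b - lineDeriv ℝ u x b) x b :=
      (HasDerivAt.sub hgx.hasLineDerivAt hux.hasLineDerivAt).sub_const c
    rw [hwx.lineDeriv]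
    ring
  calc ∫ x, lineDeriv ℝ u x b * max (g x - u x - c) 0 ∂μ
      = ∫ x, lineDeriv ℝ g x b * max (g x - u x - c) 0 ∂μ := by
        rw [integral_congr_ae hsplit, integral_sub (integrable_lineDeriv_mul hg hcont hc b)
          (integrable_lineDeriv_mul hw hcont hc b), integral_lineDeriv_mul_posPart hw hc, sub_zero]
    _ ≤ ∫ x, L * ‖b‖ * max (g x - u x - c) 0 ∂μ := by
        refine integral_mono (integrable_lineDeriv_mul hg hcont hc b)
          ((hcont.integrable_of_hasCompactSupport hc).const_mul _) fun x => ?_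
        dsimp only
        gcongr
        exact (Real.le_norm_self _).trans (norm_lineDeriv_le_of_lipschitz ℝ hg)
    _ = L * ‖b‖ * ∫ x, max (g x - u x - c) 0 ∂μ := integral_const_mul _ _

end Transport

lemma HasH10Gradient.setIntegral_inner_mul_eq_lineDeriv {v : Space N → ℝ}
    {G : Space N → Space N} (h : HasH10Gradient Ω v G) (hΩ : MeasurableSet Ω)
    (hΩfin : volume Ω ≠ ⊤) {C D : ℝ≥0} (hv : LipschitzWith C (Ω.indicator v)) {q : Space N → ℝ}
    (hq : LipschitzWith D q) (hqc : HasCompactSupport q) (b : Space N) :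
    ∫ x in Ω, inner ℝ b (G x) * q x = ∫ x, lineDeriv ℝ (Ω.indicator v) x b * q x := by
  rw [h.setIntegral_inner_mul_eq hΩfin b hq hqc, hv.integral_lineDeriv_mul_eq hq hqc,
    ← integral_indicator hΩ]
  congr 1 with x
  by_cases hx : x ∈ Ω <;> simp [hx, mul_comm]

section WeakDerivative

variable {a b : ℝ}

lemma exists_contDiff_deriv_eq {θ : ℝ → ℝ} (hθ : ContDiff ℝ ∞ θ) (hθc : HasCompactSupport θ)
    (hθab : tsupport θ ⊆ Ioo a b) (h0 : ∫ x, θ x = 0) :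
    ∃ η : ℝ → ℝ, ContDiff ℝ ∞ η ∧ HasCompactSupport η ∧ tsupport η ⊆ Ioo a b ∧ deriv η = θ := by
  rcases (tsupport θ).eq_empty_or_nonempty with he | hne
  · rw [tsupport_eq_empty_iff] at he
    exact ⟨0, contDiff_zero_fun, .zero, by simp, by simp [he]⟩
  obtain ⟨c, hc, hcle⟩ := hθc.isCompact.exists_isLeast hne
  obtain ⟨d, hd, hled⟩ := hθc.isCompact.exists_isGreatest hne
  have hθ0 : ∀ x ∉ Icc c d, θ x = 0 := fun x hx =>
    image_eq_zero_of_notMem_tsupport fun hx' => hx ⟨hcle hx', hled hx'⟩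
  have hderiv : deriv (fun r => ∫ x in a..r, θ x) = θ :=
    funext (hθ.continuous.deriv_integral θ a)
  have hsupp : (Function.support fun r => ∫ x in a..r, θ x) ⊆ Icc c d := by
    refine Function.support_subset_iff'.2 fun r hr => ?_
    rcases lt_or_ge r c with hrc | hcr
    · refine intervalIntegral.integral_zero_ae (Eventually.of_forall fun x hx =>
        hθ0 x fun hx' => ?_)
      exact (hx'.1.trans hx.2).not_gt (max_lt (hθab hc).1 hrc)
    · have hdr : d < r := lt_of_not_ge fun h => hr ⟨hcr, h⟩
      rw [intervalIntegral.integral_eq_integral_of_support_subset, h0]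
      intro x hx
      have hx' := subset_tsupport θ hx
      exact ⟨(hθab hx').1, (hled hx').trans hdr.le⟩
  refine ⟨fun r => ∫ x in a..r, θ x, ?_, .of_support_subset_isCompact isCompact_Icc hsupp, ?_,
    hderiv⟩
  · rw [contDiff_infty_iff_deriv, hderiv]
    exact ⟨fun r => (hθ.continuous.integral_hasStrictDerivAt a r).hasDerivAt.differentiableAt, hθ⟩
  · exact (closure_minimal hsupp isClosed_Icc).trans (Icc_subset_Ioo (hθab hc).1 (hθab hd).2)

-- The du Bois-Reymond lemma.
lemma exists_ae_eq_const_of_integral_mul_deriv_eq_zero {W : ℝ → ℝ} (hab : a < b)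
    (hW : IntegrableOn W (Ioo a b))
    (h : ∀ η : ℝ → ℝ, ContDiff ℝ ∞ η → HasCompactSupport η → tsupport η ⊆ Ioo a b →
      ∫ r in Ioo a b, W r * deriv η r = 0) :
    ∃ c, ∀ᵐ r ∂volume.restrict (Ioo a b), W r = c := by
  obtain ⟨B, hB⟩ : ∃ B : ContDiffBump ((a + b) / 2), tsupport (B.normed volume) ⊆ Ioo a b := by
    refine ⟨⟨(b - a) / 8, (b - a) / 4, by linarith, by linarith⟩, ?_⟩
    rw [ContDiffBump.tsupport_normed_eq, Real.closedBall_eq_Icc]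
    exact Icc_subset_Ioo (by linarith) (by linarith)
  set ψ₀ := B.normed volume
  have hψ₀d : ContDiff ℝ ∞ ψ₀ := B.contDiff_normed
  have hψ₀c : HasCompactSupport ψ₀ := B.hasCompactSupport_normed
  set c := ∫ r in Ioo a b, W r * ψ₀ r
  have hWψ : ∀ {ψ : ℝ → ℝ}, Continuous ψ → HasCompactSupport ψ →
      IntegrableOn (fun r => W r * ψ r) (Ioo a b) := fun hψ hψc => by
    obtain ⟨C, hC⟩ := hψc.exists_bound_of_continuous hψ
    exact hW.mul_bdd hψ.aestronglyMeasurable (Eventually.of_forall hC)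
  have hzero : ∀ᵐ r, r ∈ Ioo a b → W r - c = 0 := by
    refine isOpen_Ioo.ae_eq_zero_of_integral_contDiff_smul_eq_zero
      (hW.sub (integrableOn_const (by simp))).locallyIntegrableOn fun ψ hψ hψc hψab => ?_
    have hψi : Integrable ψ := hψ.continuous.integrable_of_hasCompactSupport hψc
    obtain ⟨η, hη, hηc, hηab, hηd⟩ := exists_contDiff_deriv_eq
      (θ := fun r => ψ r - (∫ x, ψ x) * ψ₀ r) (hψ.sub (contDiff_const.mul hψ₀d))
      (hψc.sub hψ₀c.mul_left)
      ((tsupport_sub _ _).trans (union_subset hψab ((tsupport_mul_subset_right).trans hB)))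
      (by rw [integral_sub hψi (B.integrable_normed.const_mul _), integral_const_mul,
            B.integral_normed, mul_one, sub_self])
    have hψW : ∫ r in Ioo a b, W r * ψ r = (∫ x, ψ x) * c := by
      have hz := h η hη hηc hηab
      simp only [hηd, mul_sub, mul_left_comm (W _)] at hz
      rw [integral_sub (hWψ hψ.continuous hψc)
        ((hWψ hψ₀d.continuous hψ₀c).const_mul _), integral_const_mul] at hz
      exact sub_eq_zero.1 hz
    have hsupp : ∀ r ∉ Ioo a b, ψ r = 0 := fun r hr =>
      image_eq_zero_of_notMem_tsupport fun hr' => hr (hψab hr')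
    rw [← setIntegral_eq_integral_of_forall_compl_eq_zero (s := Ioo a b)
      fun r hr => by rw [hsupp r hr, zero_smul]]
    simp only [smul_eq_mul, mul_sub, mul_comm (ψ _) (W _)]
    rw [integral_sub (hWψ hψ.continuous hψc) (hψi.integrableOn.mul_const c), hψW,
      integral_mul_const, setIntegral_eq_integral_of_forall_compl_eq_zero hsupp, sub_self]
  refine ⟨c, (ae_restrict_iff' measurableSet_Ioo).2 (hzero.mono fun r hr hrI => ?_)⟩
  exact sub_eq_zero.1 (hr hrI)

lemma setIntegral_primitive_mul_deriv (hab : a ≤ b) {P η : ℝ → ℝ}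
    (hP : IntervalIntegrable P volume a b) (hη : ContDiff ℝ ∞ η) (hηab : tsupport η ⊆ Ioo a b) :
    ∫ r in Ioo a b, (∫ x in a..r, P x) * deriv η r = -∫ r in Ioo a b, P r * η r := by
  have hA : AbsolutelyContinuousOnInterval (fun r => ∫ x in a..r, P x) a b :=
    hP.absolutelyContinuousOnInterval_intervalIntegral left_mem_uIcc
  have hη0 : ∀ r ∉ Ioo a b, η r = 0 := fun r hr =>
    image_eq_zero_of_notMem_tsupport fun h => hr (hηab h)
  have hibp := hA.integral_mul_deriv_eq_deriv_mul
    (hη.of_le (by simp)).contDiffOn.absolutelyContinuousOnInterval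
  rw [hη0 a (by simp), hη0 b (by simp), mul_zero, mul_zero, sub_zero, zero_sub] at hibp
  have hderiv : ∫ r in a..b, deriv (fun r => ∫ x in a..r, P x) r * η r =
      ∫ r in a..b, P r * η r := by
    refine intervalIntegral.integral_congr_ae ?_
    filter_upwards [hP.ae_hasDerivAt_integral] with r hr hrI
    rw [(hr (uIoc_subset_uIcc hrI) a left_mem_uIcc).deriv]
  simpa only [hderiv, intervalIntegral.integral_of_le hab, integral_Ioc_eq_integral_Ioo] using hibp

lemma eq_add_integral_of_setIntegral_mul_deriv_eq (hab : a < b) {Z P : ℝ → ℝ}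
    (hZ : ContinuousOn Z (Icc a b)) (hP : IntervalIntegrable P volume a b)
    (h : ∀ η : ℝ → ℝ, ContDiff ℝ ∞ η → HasCompactSupport η → tsupport η ⊆ Ioo a b →
      ∫ r in Ioo a b, Z r * deriv η r = -∫ r in Ioo a b, P r * η r) :
    ∀ t ∈ Icc a b, Z t = Z a + ∫ r in a..t, P r := by
  have hA : ContinuousOn (fun r => ∫ x in a..r, P x) (Icc a b) := by
    simpa only [uIcc_of_le hab.le] using
      (hP.absolutelyContinuousOnInterval_intervalIntegral left_mem_uIcc).continuousOn
  obtain ⟨c, hc⟩ := exists_ae_eq_const_of_integral_mul_deriv_eq_zero hab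
    ((hZ.sub hA).integrableOn_Icc.mono_set Ioo_subset_Icc_self) fun η hη hηc hηab => by
      have hmul : ∀ {F : ℝ → ℝ}, ContinuousOn F (Icc a b) →
          IntegrableOn (fun r => F r * deriv η r) (Ioo a b) := fun hF =>
        (hF.mul (hη.continuous_deriv (by simp)).continuousOn).integrableOn_Icc.mono_set
          Ioo_subset_Icc_self
      simp only [Pi.sub_apply, sub_mul]
      rw [integral_sub (hmul hZ) (hmul hA), h η hη hηc hηab,
        setIntegral_primitive_mul_deriv hab.le hP hη hηab, sub_self]
  have hIoo : EqOn (fun r => Z r - ∫ x in a..r, P x) (fun _ => c) (Ioo a b) :=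
    Measure.eqOn_open_of_ae_eq hc isOpen_Ioo ((hZ.sub hA).mono Ioo_subset_Icc_self)
      continuousOn_const
  have hIcc : EqOn (fun r => Z r - ∫ x in a..r, P x) (fun _ => c) (Icc a b) :=
    hIoo.of_subset_closure (hZ.sub hA) continuousOn_const Ioo_subset_Icc_self
      (closure_Ioo hab.ne).superset
  intro t ht
  have hta := (hIcc ht).trans (hIcc (left_mem_Icc.2 hab.le)).symm
  simp only [intervalIntegral.integral_same] at hta
  linarith

end WeakDerivative

section TensorProduct

variable {E : Type*} [NormedAddCommGroup E]

lemma tsupport_mul_prod_subset (η : ℝ → ℝ) (χ : E → ℝ) :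
    tsupport (fun q : ℝ × E => η q.1 * χ q.2) ⊆ tsupport η ×ˢ tsupport χ :=
  closure_minimal (fun _ hq => ⟨subset_tsupport _ (left_ne_zero_of_mul hq),
    subset_tsupport _ (right_ne_zero_of_mul hq)⟩)
    ((isClosed_tsupport η).prod (isClosed_tsupport χ))

lemma hasCompactSupport_mul_prod {η : ℝ → ℝ} {χ : E → ℝ} (hη : HasCompactSupport η)
    (hχ : HasCompactSupport χ) : HasCompactSupport fun q : ℝ × E => η q.1 * χ q.2 :=
  (hη.isCompact.prod hχ.isCompact).of_isClosed_subset (isClosed_tsupport _)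
    (tsupport_mul_prod_subset η χ)

lemma fderiv_mul_prod_apply [NormedSpace ℝ E] {η : ℝ → ℝ} {χ : E → ℝ} (hη : Differentiable ℝ η)
    (hχ : Differentiable ℝ χ) (q : ℝ × E) :
    fderiv ℝ (fun q : ℝ × E => η q.1 * χ q.2) q (1, 0) = deriv η q.1 * χ q.2 := by
  have hη' : HasFDerivAt (fun q : ℝ × E => η q.1)
      ((fderiv ℝ η q.1).comp (ContinuousLinearMap.fst ℝ ℝ E)) q :=
    (hη q.1).hasFDerivAt.comp q hasFDerivAt_fst
  have hχ' : HasFDerivAt (fun q : ℝ × E => χ q.2)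
      ((fderiv ℝ χ q.2).comp (ContinuousLinearMap.snd ℝ ℝ E)) q :=
    (hχ q.2).hasFDerivAt.comp q hasFDerivAt_snd
  rw [(hη'.fun_mul hχ').fderiv]
  simp [mul_comm]

end TensorProduct

section Cylinder

variable {T : ℝ} {z p : ℝ → Space N → ℝ} {χ : Space N → ℝ}

lemma restrict_prod_eq (I : Set ℝ) (Ω : Set (Space N)) :
    (volume : Measure (ℝ × Space N)).restrict (I ×ˢ Ω) =
      (volume.restrict I).prod (volume.restrict Ω) := by
  rw [Measure.volume_eq_prod, Measure.prod_restrict]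

lemma setIntegral_prod_mul_mul {w : ℝ → Space N → ℝ} {g : ℝ → ℝ} {I : Set ℝ}
    (hw : IntegrableOn (fun q : ℝ × Space N => w q.1 q.2) (I ×ˢ Ω)) (hg : Continuous g)
    (hgc : HasCompactSupport g) (hχ : Continuous χ) (hχc : HasCompactSupport χ) :
    ∫ q in I ×ˢ Ω, w q.1 q.2 * (g q.1 * χ q.2) =
      ∫ r in I, (∫ x in Ω, w r x * χ x) * g r := by
  obtain ⟨C, hC⟩ := (hasCompactSupport_mul_prod hgc hχc).exists_bound_of_continuous
    (by fun_prop)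
  have hint := hw.mul_bdd (by fun_prop) (Eventually.of_forall hC)
  rw [restrict_prod_eq] at hint ⊢
  rw [integral_prod _ hint]
  simp only [← integral_mul_const, mul_assoc, mul_comm (χ _)]

lemma integrableOn_prod_mul {I : Set ℝ}
    (hp : IntegrableOn (fun q : ℝ × Space N => p q.1 q.2) (I ×ˢ Ω)) (hχ : Continuous χ)
    (hχc : HasCompactSupport χ) :
    Integrable (fun q : ℝ × Space N => p q.1 q.2 * χ q.2)
      ((volume.restrict I).prod (volume.restrict Ω)) := by
  obtain ⟨C, hC⟩ := hχc.exists_bound_of_continuous hχ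
  rw [← restrict_prod_eq]
  exact hp.mul_bdd (hχ.comp continuous_snd).aestronglyMeasurable
    (Eventually.of_forall fun q => hC q.2)

lemma continuousOn_setIntegral_mul (hΩ : MeasurableSet Ω) (hb : Bornology.IsBounded Ω)
    {I : Set ℝ} (hI : IsCompact I)
    (hz : ContinuousOn (fun q : ℝ × Space N => z q.1 q.2) (I ×ˢ closure Ω))
    (hχ : Continuous χ) : ContinuousOn (fun r => ∫ x in Ω, z r x * χ x) I := by
  have : IsFiniteMeasure (volume.restrict Ω) := ⟨by simpa using hb.measure_lt_top⟩
  have hzχ : ContinuousOn (Function.uncurry fun r x => z r x * χ x) (I ×ˢ closure Ω) :=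
    hz.mul (hχ.comp continuous_snd).continuousOn
  obtain ⟨B, hB⟩ := (hI.prod hb.isCompact_closure).exists_bound_of_continuousOn hzχ
  refine continuousOn_of_dominated (bound := fun _ => B) (fun r hr => ?_) (fun r hr => ?_)
    (integrable_const _) ?_
  · exact (hzχ.uncurry_left r hr).mono subset_closure |>.aestronglyMeasurable hΩ
  · filter_upwards [ae_restrict_mem hΩ] with x hx using hB (r, x) ⟨hr, subset_closure hx⟩
  · filter_upwards [ae_restrict_mem hΩ] with x hx
    exact hzχ.uncurry_right x (subset_closure hx)

lemma HasWeakTimeDeriv.setIntegral_mul_eq (h : HasWeakTimeDeriv Ω T z p) (hT : 0 < T)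
    (hΩ : MeasurableSet Ω) (hb : Bornology.IsBounded Ω)
    (hz : ContinuousOn (fun q : ℝ × Space N => z q.1 q.2) (Icc 0 T ×ˢ closure Ω))
    (hp : IntegrableOn (fun q : ℝ × Space N => p q.1 q.2) (cylinder Ω T))
    (hχ : ContDiff ℝ ∞ χ) (hχc : HasCompactSupport χ) (hχΩ : tsupport χ ⊆ Ω) :
    ∀ t ∈ Icc 0 T,
      ∫ x in Ω, z t x * χ x = (∫ x in Ω, z 0 x * χ x) + ∫ r in 0..t, ∫ x in Ω, p r x * χ x := by
  refine eq_add_integral_of_setIntegral_mul_deriv_eq hT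
    (continuousOn_setIntegral_mul hΩ hb isCompact_Icc hz hχ.continuous) ?_ fun η hη hηc hηT => ?_
  · rw [intervalIntegrable_iff_integrableOn_Ioo_of_le hT.le]
    exact (integrableOn_prod_mul hp hχ.continuous hχc).integral_prod_left
  · have hzi : IntegrableOn (fun q : ℝ × Space N => z q.1 q.2) (cylinder Ω T) :=
      (hz.integrableOn_compact (isCompact_Icc.prod hb.isCompact_closure)).mono_set
        (prod_mono Ioo_subset_Icc_self subset_closure)
    have hweak := h (fun q => η q.1 * χ q.2) (by fun_prop) (hasCompactSupport_mul_prod hηc hχc)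
      ((tsupport_mul_prod_subset η χ).trans (prod_mono hηT hχΩ))
    simp only [fderiv_mul_prod_apply (hη.differentiable (by simp)) (hχ.differentiable (by simp)),
      cylinder] at hweak
    rwa [setIntegral_prod_mul_mul hzi (hη.continuous_deriv (by simp)) hηc.deriv hχ.continuous hχc,
      setIntegral_prod_mul_mul hp hη.continuous hηc hχ.continuous hχc] at hweak

lemma HasWeakTimeDeriv.ae_eq_add_integral (h : HasWeakTimeDeriv Ω T z p) (hT : 0 < T)
    (hΩ : IsOpen Ω) (hb : Bornology.IsBounded Ω)
    (hz : ContinuousOn (fun q : ℝ × Space N => z q.1 q.2) (Icc 0 T ×ˢ closure Ω))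
    (hp : IntegrableOn (fun q : ℝ × Space N => p q.1 q.2) (cylinder Ω T))
    {t : ℝ} (ht : t ∈ Icc 0 T) :
    ∀ᵐ x ∂volume.restrict Ω, z t x = z 0 x + ∫ r in 0..t, p r x := by
  have hzr : ∀ r ∈ Icc 0 T, IntegrableOn (z r) Ω := fun r hr =>
    ((hz.uncurry_left r hr).integrableOn_compact hb.isCompact_closure).mono_set subset_closure
  have hz0 := hzr 0 (left_mem_Icc.2 hT.le)
  have hpt : IntegrableOn (fun q : ℝ × Space N => p q.1 q.2) (Ioc 0 t ×ˢ Ω) := by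
    have hpT : IntegrableOn (fun q : ℝ × Space N => p q.1 q.2) (Ioc 0 T ×ˢ Ω) := by
      rwa [IntegrableOn, restrict_prod_eq, ← restrict_Ioo_eq_restrict_Ioc, ← restrict_prod_eq]
    exact hpT.mono_set (prod_mono (Ioc_subset_Ioc_right ht.2) subset_rfl)
  have hpi : IntegrableOn (fun x => ∫ r in 0..t, p r x) Ω := by
    rw [IntegrableOn, restrict_prod_eq] at hpt
    simp only [intervalIntegral.integral_of_le ht.1]
    exact hpt.integral_prod_right
  have hae := hΩ.ae_eq_zero_of_integral_contDiff_smul_eq_zero (μ := volume)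
    (f := fun x => z t x - (z 0 x + ∫ r in 0..t, p r x))
    ((hzr t ht).sub (hz0.add hpi)).locallyIntegrableOn fun χ hχ hχc hχΩ => ?_
  · refine (ae_restrict_iff' hΩ.measurableSet).2 (hae.mono fun x hx hxΩ => ?_)
    exact sub_eq_zero.1 (hx hxΩ)
  obtain ⟨C, hC⟩ := hχc.exists_bound_of_continuous hχ.continuous
  have hmul : ∀ {g : Space N → ℝ}, IntegrableOn g Ω → IntegrableOn (fun x => g x * χ x) Ω :=
    fun hg => hg.mul_bdd hχ.continuous.aestronglyMeasurable (Eventually.of_forall hC)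
  have hswap : ∫ r in 0..t, ∫ x in Ω, p r x * χ x = ∫ x in Ω, (∫ r in 0..t, p r x) * χ x := by
    simp only [intervalIntegral.integral_of_le ht.1]
    rw [integral_integral_swap (integrableOn_prod_mul hpt hχ.continuous hχc)]
    simp only [integral_mul_const]
  rw [← setIntegral_eq_integral_of_forall_compl_eq_zero (s := Ω) fun x hx => by
    rw [image_eq_zero_of_notMem_tsupport fun hx' => hx (hχΩ hx'), zero_smul]]
  simp only [smul_eq_mul, mul_comm (χ _), sub_mul, add_mul]
  rw [integral_sub (hmul (hzr t ht)) (by exact (hmul hz0).add (hmul hpi)),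
    integral_add (hmul hz0) (hmul hpi), ← hswap,
    h.setIntegral_mul_eq hT hΩ.measurableSet hb hz hp hχ hχc hχΩ t ht, sub_self]

lemma HasWeakTimeDeriv.ae_forall_eq_add_integral (h : HasWeakTimeDeriv Ω T z p) (hT : 0 < T)
    (hΩ : IsOpen Ω) (hb : Bornology.IsBounded Ω)
    (hz : ContinuousOn (fun q : ℝ × Space N => z q.1 q.2) (Icc 0 T ×ˢ closure Ω))
    (hp : IntegrableOn (fun q : ℝ × Space N => p q.1 q.2) (cylinder Ω T)) :
    ∀ᵐ x ∂volume.restrict Ω, IntervalIntegrable (fun r => p r x) volume 0 T ∧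
      ∀ s ∈ Icc 0 T, ∀ t ∈ Icc 0 T, z t x = z s x + ∫ r in s..t, p r x := by
  have hrat : ∀ᵐ x ∂volume.restrict Ω, ∀ r : ℚ, (r : ℝ) ∈ Icc 0 T →
      z r x = z 0 x + ∫ τ in 0..(r : ℝ), p τ x := by
    refine ae_all_iff.2 fun r => ?_
    by_cases hr : (r : ℝ) ∈ Icc 0 T
    · exact (h.ae_eq_add_integral hT hΩ hb hz hp hr).mono fun x hx _ => hx
    · exact Eventually.of_forall fun x hx => absurd hx hr
  have hpp := hp
  rw [IntegrableOn, cylinder, restrict_prod_eq] at hpp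
  filter_upwards [hrat, hpp.prod_left_ae, ae_restrict_mem hΩ.measurableSet] with x hx hpx hxΩ
  have hpx' : IntervalIntegrable (fun r => p r x) volume 0 T :=
    (intervalIntegrable_iff_integrableOn_Ioo_of_le hT.le).2 hpx
  have hx0 : EqOn (fun t => z t x) (fun t => z 0 x + ∫ r in 0..t, p r x) (Icc 0 T) := by
    refine EqOn.of_subset_closure (s := Ioo 0 T ∩ range ((↑) : ℚ → ℝ)) ?_
      (hz.uncurry_right x (subset_closure hxΩ)) ?_ (inter_subset_left.trans Ioo_subset_Icc_self) ?_
    · rintro _ ⟨hr, r, rfl⟩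
      exact hx r (Ioo_subset_Icc_self hr)
    · rw [← uIcc_of_le hT.le]
      exact continuousOn_const.add
        (hpx'.absolutelyContinuousOnInterval_intervalIntegral left_mem_uIcc).continuousOn
    · rw [← closure_Ioo hT.ne]
      exact closure_minimal (Rat.denseRange_cast.open_subset_closure_inter isOpen_Ioo)
        isClosed_closure
  refine ⟨hpx', fun s hs t ht => ?_⟩
  have hp0 : ∀ r ∈ Icc 0 T, IntervalIntegrable (fun r => p r x) volume 0 r := fun r hr =>
    hpx'.mono_set (uIcc_subset_uIcc_left (uIcc_of_le hT.le ▸ hr))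
  have hst := intervalIntegral.integral_interval_sub_left (hp0 t ht) (hp0 s hs)
  linarith [hx0 hs, hx0 ht]

end Cylinder

section Energy

lemma absolutelyContinuousOnInterval_posPart {g : ℝ → ℝ} {s t : ℝ}
    (hg : AbsolutelyContinuousOnInterval g s t) :
    AbsolutelyContinuousOnInterval (fun r => max (g r) 0) s t :=
  squeeze_zero (fun _ => Finset.sum_nonneg fun _ _ => dist_nonneg)
    (fun _ => Finset.sum_le_sum fun _ _ => abs_max_sub_max_le_abs _ _ _) hg

lemma posPart_sq_sub_eq_integral {g r : ℝ → ℝ} {s t : ℝ} (hst : s ≤ t)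
    (hr : IntervalIntegrable r volume s t) (hg : ∀ τ ∈ Icc s t, g τ = g s + ∫ x in s..τ, r x) :
    max (g t) 0 ^ 2 - max (g s) 0 ^ 2 = 2 * ∫ τ in s..t, max (g τ) 0 * r τ := by
  set k : ℝ → ℝ := fun τ => g s + ∫ x in s..τ, r x with hk
  have hm : AbsolutelyContinuousOnInterval (fun τ => max (k τ) 0) s t :=
    absolutelyContinuousOnInterval_posPart <|
      (contDiff_const (c := g s)).contDiffOn.absolutelyContinuousOnInterval.add
        (hr.absolutelyContinuousOnInterval_intervalIntegral left_mem_uIcc)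
  have hderiv : ∫ τ in s..t, max (k τ) 0 * deriv (fun τ => max (k τ) 0) τ =
      ∫ τ in s..t, max (g τ) 0 * r τ := by
    refine intervalIntegral.integral_congr_ae ?_
    filter_upwards [hr.ae_hasDerivAt_integral] with τ hτ hτI
    have hkτ : HasDerivAt k (r τ) τ :=
      (hτ (uIoc_subset_uIcc hτI) s left_mem_uIcc).const_add (g s)
    rw [uIoc_of_le hst] at hτI
    rw [hg τ (Ioc_subset_Icc_self hτI)]
    change max (k τ) 0 * _ = max (k τ) 0 * _
    rcases le_or_gt (k τ) 0 with h | h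
    · rw [max_eq_right h, zero_mul, zero_mul]
    · have hloc : (fun τ => max (k τ) 0) =ᶠ[𝓝 τ] k :=
        (hkτ.continuousAt.eventually_const_lt h).mono fun y hy => max_eq_left hy.le
      rw [hloc.deriv_eq, hkτ.deriv]
  have hibp := hm.integral_mul_deriv_eq_deriv_mul hm
  simp only [mul_comm (deriv _ _), hderiv] at hibp
  have hks : k s = g s := by simp only [hk, intervalIntegral.integral_same, add_zero]
  rw [show g t = k t from hg t (right_mem_Icc.2 hst), ← hks]
  linarith

variable {X : Type*} [MeasurableSpace X] {μ : Measure X} [SFinite μ]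

lemma ae_nonpos_of_integral_posPart_mul_nonpos {w r : ℝ → X → ℝ} {s t : ℝ} (hst : s ≤ t)
    (hwr : Integrable (fun q : ℝ × X => max (w q.1 q.2) 0 * r q.1 q.2)
      ((volume.restrict (Ioc s t)).prod μ))
    (hw : ∀ᵐ x ∂μ, IntervalIntegrable (fun τ => r τ x) volume s t ∧
      ∀ τ ∈ Icc s t, w τ x = w s x + ∫ σ in s..τ, r σ x)
    (hs : ∀ᵐ x ∂μ, w s x ≤ 0)
    (hle : ∀ᵐ τ ∂volume.restrict (Ioc s t), ∫ x, max (w τ x) 0 * r τ x ∂μ ≤ 0) :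
    ∀ᵐ x ∂μ, w t x ≤ 0 := by
  have henergy : (fun x => max (w t x) 0 ^ 2) =ᵐ[μ]
      fun x => 2 * ∫ τ in Ioc s t, max (w τ x) 0 * r τ x := by
    filter_upwards [hw, hs] with x hx hxs
    have hsq := posPart_sq_sub_eq_integral hst hx.1 hx.2
    rwa [max_eq_right hxs, zero_pow two_ne_zero, sub_zero,
      intervalIntegral.integral_of_le hst] at hsq
  have hint : Integrable (fun x => max (w t x) 0 ^ 2) μ :=
    (hwr.integral_prod_right.const_mul 2).congr henergy.symm
  have hnonpos : ∫ x, max (w t x) 0 ^ 2 ∂μ ≤ 0 := by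
    rw [integral_congr_ae henergy, integral_const_mul, ← integral_integral_swap hwr]
    exact mul_nonpos_of_nonneg_of_nonpos two_pos.le (integral_nonpos_of_ae hle)
  have hzero := (integral_eq_zero_iff_of_nonneg (fun x => sq_nonneg _) hint).1
    (hnonpos.antisymm (integral_nonneg fun x => sq_nonneg _))
  filter_upwards [hzero] with x hx
  exact max_eq_right_iff.1 (pow_eq_zero_iff two_ne_zero |>.1 hx)

end Energy

section Geometry

lemma HasC2Boundary.interior_closure_eq (h : HasC2Boundary Ω) (hΩ : IsOpen Ω) :
    interior (closure Ω) = Ω := by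
  refine Subset.antisymm (fun x₀ hx₀ => ?_) (interior_maximal subset_closure hΩ)
  by_contra hx₀Ω
  have hx₀f : x₀ ∈ frontier Ω := hΩ.frontier_eq ▸ ⟨interior_subset hx₀, hx₀Ω⟩
  obtain ⟨U, hU, ρ, hρ, hdρ, hUρ⟩ := h x₀ hx₀f
  have hρ0 : 0 ≤ ρ x₀ := not_lt.1 fun hlt => hx₀Ω ((hUρ x₀ (mem_of_mem_nhds hU)).2 hlt)
  have hmax : IsLocalMax ρ x₀ := by
    filter_upwards [mem_interior_iff_mem_nhds.1 hx₀, eventually_mem_nhds_iff.2 hU] with x hx hxU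
    refine le_trans (not_lt.1 fun hpos => ?_) hρ0
    obtain ⟨y, hyΩ, hyρ, hyU⟩ := ((mem_closure_iff_frequently.1 hx).and_eventually
      ((hρ.continuous.continuousAt.eventually_const_lt hpos).and hxU)).exists
    exact ((hUρ y hyU).1 hyΩ).not_gt hyρ
  exact hdρ hmax.fderiv_eq_zero

lemma compl_nonempty_of_isBounded (hN : 1 ≤ N) (hb : Bornology.IsBounded Ω) : Ωᶜ.Nonempty := by
  have : Nonempty (Fin N) := ⟨⟨0, hN⟩⟩
  refine nonempty_compl.2 ?_
  rintro rfl
  exact NormedSpace.unbounded_univ ℝ (Space N) hb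

lemma bdist_eq_infDist_compl (hΩ : IsOpen Ω) (hc : Ωᶜ.Nonempty) {x : Space N}
    (hx : x ∈ closure Ω) : bdist Ω x = Metric.infDist x Ωᶜ := by
  have hsub : frontier Ω ⊆ Ωᶜ := hΩ.frontier_eq ▸ fun y hy => hy.2
  by_cases hxΩ : x ∈ Ω
  · obtain ⟨y, hy, hxy⟩ := exists_mem_frontier_infDist_compl_eq_dist hxΩ (nonempty_compl.1 hc)
    exact (hxy ▸ Metric.infDist_le_dist_of_mem hy).antisymm
      (Metric.infDist_le_infDist_of_subset hsub ⟨y, hy⟩)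
  · have hxf : x ∈ frontier Ω := hΩ.frontier_eq ▸ ⟨hx, hxΩ⟩
    rw [bdist, Metric.infDist_zero_of_mem hxf, Metric.infDist_zero_of_mem hxΩ]

lemma bdist_le_maxBdist (hb : Bornology.IsBounded Ω) {x : Space N} (hx : x ∈ closure Ω) :
    bdist Ω x ≤ maxBdist Ω :=
  le_csSup (hb.isCompact_closure.image (Metric.continuous_infDist_pt _)).bddAbove
    (mem_image_of_mem _ hx)

lemma maxBdist_nonneg : 0 ≤ maxBdist Ω :=
  Real.sSup_nonneg (by rintro _ ⟨x, -, rfl⟩; exact Metric.infDist_nonneg)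

end Geometry

section ConvexSets

/-- The property shared by the two convex sets which the comparison argument uses: `K` consists of
functions with `|v| ≤ d`, and `K` is stable under raising `v` to the truncated distance
`max (d - c) v`. The distance `d` is encoded as the distance to `Ωᶜ` and `v` is extended by zero,
so that the raised function is defined on the whole space and vanishes off `Ω`. -/
structure IsDistStable (Ω : Set (Space N)) (K : Set (Space N → ℝ)) : Prop where
  abs_le_infDist : ∀ v ∈ K, ContinuousOn v Ω → ∀ x ∈ Ω, |v x| ≤ Metric.infDist x Ωᶜ
  max_mem : ∀ v ∈ K, ∀ C : ℝ≥0, LipschitzWith C (Ω.indicator v) → ∀ c : ℝ, 0 ≤ c →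
    (fun x => max (Metric.infDist x Ωᶜ - c) (Ω.indicator v x)) ∈ K

lemma lipschitzWith_infDist_sub_const (s : Set (Space N)) (c : ℝ) :
    LipschitzWith 1 fun x => Metric.infDist x s - c := by
  simpa using! (Metric.lipschitz_infDist_pt s).sub (LipschitzWith.const c)

lemma max_infDist_sub_indicator_eq_zero {v : Space N → ℝ} {c : ℝ} (hc : 0 ≤ c) {x : Space N}
    (hx : x ∉ Ω) : max (Metric.infDist x Ωᶜ - c) (Ω.indicator v x) = 0 := by
  rw [indicator_of_notMem hx, Metric.infDist_zero_of_mem hx, zero_sub,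
    max_eq_right (neg_nonpos.2 hc)]

lemma continuousOn_of_lipschitzWith_indicator {v : Space N → ℝ} {C : ℝ≥0}
    (hC : LipschitzWith C (Ω.indicator v)) : ContinuousOn v Ω :=
  hC.continuous.continuousOn.congr fun _ hx => (indicator_of_mem hx v).symm

lemma isDistStable_gradientSet (hΩ : interior (closure Ω) = Ω) (hb : Bornology.IsBounded Ω)
    (hne : Ωᶜ.Nonempty) : IsDistStable Ω (gradientSet Ω) := by
  have hlip : ∀ v ∈ gradientSet Ω, ContinuousOn v Ω → LipschitzWith 1 (Ω.indicator v) := by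
    rintro v ⟨G, hG, hG1⟩ hv
    exact hG.lipschitzWith hΩ hb.measure_lt_top.ne hv hG1
  refine ⟨fun v hv hvc x hx => (Metric.le_infDist hne).2 fun y hy => ?_,
    fun v hv C hC c hc => ?_⟩
  · simpa [indicator_of_mem hx, indicator_of_notMem hy] using (hlip v hv hvc).dist_le_mul x y
  · have hmax := (lipschitzWith_infDist_sub_const Ωᶜ c).max
      (hlip v hv (continuousOn_of_lipschitzWith_indicator hC))
    obtain ⟨G, hG, hG1⟩ := exists_hasH10Gradient_of_lipschitz (hΩ ▸ isOpen_interior) hb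
      (max_self (1 : ℝ≥0) ▸ hmax) fun x => max_infDist_sub_indicator_eq_zero hc
    exact ⟨G, hG, Eventually.of_forall hG1⟩

lemma isDistStable_obstacleSet (hΩ : IsOpen Ω) (hb : Bornology.IsBounded Ω) (hne : Ωᶜ.Nonempty) :
    IsDistStable Ω (obstacleSet Ω) := by
  have habs : ∀ v ∈ obstacleSet Ω, ContinuousOn v Ω → ∀ x ∈ Ω, |v x| ≤ Metric.infDist x Ωᶜ := by
    rintro v ⟨-, hvd⟩ hv
    refine le_of_ae_restrict_le (μ := volume) hΩ hv.abs
      (Metric.continuous_infDist_pt _).continuousOn ?_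
    filter_upwards [hvd, ae_restrict_mem hΩ.measurableSet] with x hx hxΩ
    rw [bdist_eq_infDist_compl hΩ hne (subset_closure hxΩ)] at hx
    exact abs_le.2 hx
  refine ⟨habs, fun v hv C hC c hc => ?_⟩
  obtain ⟨G, hG, -⟩ := exists_hasH10Gradient_of_lipschitz hΩ hb
    ((lipschitzWith_infDist_sub_const Ωᶜ c).max hC) fun x => max_infDist_sub_indicator_eq_zero hc
  refine ⟨⟨G, hG⟩, ?_⟩
  filter_upwards [ae_restrict_mem hΩ.measurableSet] with x hx
  obtain ⟨hlow, hupp⟩ := abs_le.1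
    (habs v hv (continuousOn_of_lipschitzWith_indicator hC) x hx)
  rw [bdist_eq_infDist_compl hΩ hne (subset_closure hx), indicator_of_mem hx]
  exact ⟨hlow.trans (le_max_right _ _), max_le (sub_le_self _ hc) hupp⟩

end ConvexSets

section FixedTime

lemma setIntegral_posPart_mul_sub_nonpos (hΩ : MeasurableSet Ω) (hb : Bornology.IsBounded Ω)
    {b : Space N} {v p : Space N → ℝ} {G : Space N → Space N} {K : Set (Space N → ℝ)}
    (hK : IsDistStable Ω K) (hv : v ∈ K) (hG : HasH10Gradient Ω v G) {C : ℝ≥0}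
    (hC : LipschitzWith C (Ω.indicator v)) (hp : IntegrableOn p Ω) {a δ c : ℝ}
    (ha : ‖b‖ + δ ≤ a) (hc : 0 ≤ c)
    (hvi : ∀ w ∈ K, ∫ x in Ω, a * (w x - v x) ≤
      (∫ x in Ω, p x * (w x - v x)) + ∫ x in Ω, inner ℝ b (G x) * (w x - v x)) :
    ∫ x in Ω, max (Metric.infDist x Ωᶜ - v x - c) 0 * (δ - p x) ≤ 0 := by
  set q : Space N → ℝ := fun x => max (Metric.infDist x Ωᶜ - Ω.indicator v x - c) 0 with hq
  have hql : LipschitzWith (1 + C + 0) q :=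
    (((Metric.lipschitz_infDist_pt Ωᶜ).sub hC).sub (.const c)).max_const 0
  have hq0 : ∀ x ∉ Ω, q x = 0 := fun x hx => by
    simp only [hq, indicator_of_notMem hx, Metric.infDist_zero_of_mem (mem_compl hx), sub_zero,
      zero_sub, max_eq_right (neg_nonpos.2 hc)]
  have hqc : HasCompactSupport q :=
    .intro hb.isCompact_closure fun x hx => hq0 x fun hxΩ => hx (subset_closure hxΩ)
  have hqi : IntegrableOn q Ω := (hql.continuous.integrable_of_hasCompactSupport hqc).integrableOn
  have hpq : IntegrableOn (fun x => p x * q x) Ω := by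
    obtain ⟨B, hB⟩ := hqc.exists_bound_of_continuous hql.continuous
    exact hp.mul_bdd hql.continuous.aestronglyMeasurable (Eventually.of_forall hB)
  have htest : ∀ m : Space N → ℝ,
      ∫ x in Ω, m x * (max (Metric.infDist x Ωᶜ - c) (Ω.indicator v x) - v x) =
        ∫ x in Ω, m x * q x := fun m =>
    setIntegral_congr_fun hΩ fun x hx => by
      simp only [hq, indicator_of_mem hx, ← max_sub_sub_right, sub_self, sub_right_comm]
  have htransport : ∫ x in Ω, inner ℝ b (G x) * q x ≤ ‖b‖ * ∫ x in Ω, q x := by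
    rw [hG.setIntegral_inner_mul_eq_lineDeriv hΩ hb.measure_lt_top.ne hC hql hqc,
      setIntegral_eq_integral_of_forall_compl_eq_zero hq0]
    simpa using integral_lineDeriv_mul_posPart_sub_le hC (Metric.lipschitz_infDist_pt Ωᶜ) c hqc b
  have hvi' := hvi _ (hK.max_mem v hv C hC c hc)
  rw [htest fun _ => a, htest p, htest fun x => inner ℝ b (G x), integral_const_mul] at hvi'
  have hgap : (‖b‖ + δ) * ∫ x in Ω, q x ≤ a * ∫ x in Ω, q x :=
    mul_le_mul_of_nonneg_right ha (integral_nonneg fun x => le_max_right _ _)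
  calc ∫ x in Ω, max (Metric.infDist x Ωᶜ - v x - c) 0 * (δ - p x)
      = ∫ x in Ω, (δ * q x - p x * q x) := setIntegral_congr_fun hΩ fun x hx => by
        simp only [hq, indicator_of_mem hx]
        ring
    _ = δ * (∫ x in Ω, q x) - ∫ x in Ω, p x * q x := by
        rw [integral_sub (hqi.const_mul δ) hpq, integral_const_mul]
    _ ≤ 0 := by linarith

end FixedTime

section Comparison

variable {T : ℝ} {K : Set (Space N → ℝ)} {b : Space N} {f : ℝ → ℝ} {z p : ℝ → Space N → ℝ}
  {G : ℝ → Space N → Space N}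

lemma exists_ae_ae_norm_le
    (hG : MemLp (fun q : ℝ × Space N => G q.1 q.2) ⊤ (volume.restrict (cylinder Ω T))) :
    ∃ M : ℝ≥0, ∀ᵐ t ∂volume.restrict (Ioo 0 T), ∀ᵐ x ∂volume.restrict Ω, ‖G t x‖ ≤ M := by
  rw [cylinder, restrict_prod_eq] at hG
  refine ⟨(eLpNorm (fun q : ℝ × Space N => G q.1 q.2) ⊤
    ((volume.restrict (Ioo 0 T)).prod (volume.restrict Ω))).toNNReal,
    Measure.ae_ae_of_ae_prod (p := fun q : ℝ × Space N => ‖G q.1 q.2‖ ≤ _) ?_⟩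
  filter_upwards [ae_le_eLpNormEssSup (f := fun q : ℝ × Space N => G q.1 q.2)
    (μ := (volume.restrict (Ioo 0 T)).prod (volume.restrict Ω))] with q hq
  rw [← eLpNorm_exponent_top] at hq
  have hnorm := (ENNReal.toReal_le_toReal enorm_ne_top hG.2.ne).2 hq
  rwa [toReal_enorm] at hnorm

lemma ae_setIntegral_posPart_mul_sub_nonpos (hΩ : interior (closure Ω) = Ω)
    (hb : Bornology.IsBounded Ω) (hK : IsDistStable Ω K)
    (hz : ContinuousOn (fun q : ℝ × Space N => z q.1 q.2) (Icc 0 T ×ˢ closure Ω))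
    (hp : IntegrableOn (fun q : ℝ × Space N => p q.1 q.2) (cylinder Ω T))
    (hG : MemLp (fun q : ℝ × Space N => G q.1 q.2) ⊤ (volume.restrict (cylinder Ω T)))
    (hzG : ∀ᵐ t ∂volume.restrict (Ioo 0 T), HasH10Gradient Ω (z t) (G t))
    (hvi : ∀ᵐ t ∂volume.restrict (Ioo 0 T), z t ∈ K ∧ ∀ v ∈ K,
      ∫ x in Ω, f t * (v x - z t x) ≤
        (∫ x in Ω, p t x * (v x - z t x)) + ∫ x in Ω, inner ℝ b (G t x) * (v x - z t x)) :
    ∀ᵐ t ∂volume.restrict (Ioo 0 T), ∀ c δ : ℝ, 0 ≤ c → ‖b‖ + δ ≤ f t →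
      ∫ x in Ω, max (Metric.infDist x Ωᶜ - z t x - c) 0 * (δ - p t x) ≤ 0 := by
  have hΩm : MeasurableSet Ω := hΩ ▸ isOpen_interior.measurableSet
  obtain ⟨M, hM⟩ := exists_ae_ae_norm_le hG
  rw [IntegrableOn, cylinder, restrict_prod_eq] at hp
  filter_upwards [hzG, hvi, hM, hp.prod_right_ae, ae_restrict_mem measurableSet_Ioo]
    with t hGt hvit hMt hpt ht c δ hc hδ
  have hlip : LipschitzWith M (Ω.indicator (z t)) := hGt.lipschitzWith hΩ hb.measure_lt_top.ne
    ((hz.uncurry_left t (Ioo_subset_Icc_self ht)).mono subset_closure) hMt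
  exact setIntegral_posPart_mul_sub_nonpos hΩm hb hK hvit.1 hGt hlip hpt hδ hc hvit.2

lemma HasWeakTimeDeriv.ae_infDist_sub_eq_add_integral (h : HasWeakTimeDeriv Ω T z p) (hT : 0 < T)
    (hΩ : IsOpen Ω) (hb : Bornology.IsBounded Ω)
    (hz : ContinuousOn (fun q : ℝ × Space N => z q.1 q.2) (Icc 0 T ×ˢ closure Ω))
    (hp : IntegrableOn (fun q : ℝ × Space N => p q.1 q.2) (cylinder Ω T)) {s t : ℝ}
    (hs : s ∈ Ioo 0 T) (ht : t ∈ Ioo 0 T) (hst : s ≤ t) (D δ : ℝ) :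
    ∀ᵐ x ∂volume.restrict Ω, IntervalIntegrable (fun τ => δ - p τ x) volume s t ∧
      ∀ τ ∈ Icc s t, Metric.infDist x Ωᶜ - z τ x - (D - δ * (τ - s)) =
        Metric.infDist x Ωᶜ - z s x - (D - δ * (s - s)) + ∫ σ in s..τ, (δ - p σ x) := by
  filter_upwards [h.ae_forall_eq_add_integral hT hΩ hb hz hp] with x ⟨hpx, hx⟩
  have hps : ∀ τ ∈ Icc s t, IntervalIntegrable (fun r => p r x) volume s τ := fun τ hτ =>
    hpx.mono_set (uIcc_subset_uIcc (by grind [uIcc_of_le]) (by grind [uIcc_of_le]))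
  refine ⟨intervalIntegrable_const.sub (hps t (right_mem_Icc.2 hst)), fun τ hτ => ?_⟩
  rw [intervalIntegral.integral_sub intervalIntegrable_const (hps τ hτ),
    intervalIntegral.integral_const, smul_eq_mul, hx s (by grind) τ (by grind)]
  ring

lemma integrable_posPart_mul_sub (hΩ : MeasurableSet Ω) (hb : Bornology.IsBounded Ω)
    {w : ℝ → Space N → ℝ} {I : Set ℝ} (hI : IsCompact I)
    (hw : ContinuousOn (fun q : ℝ × Space N => w q.1 q.2) (I ×ˢ closure Ω))
    (hp : IntegrableOn (fun q : ℝ × Space N => p q.1 q.2) (I ×ˢ Ω)) (δ : ℝ) :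
    IntegrableOn (fun q : ℝ × Space N => max (w q.1 q.2) 0 * (δ - p q.1 q.2)) (I ×ˢ Ω) := by
  have hq : ContinuousOn (fun q : ℝ × Space N => max (w q.1 q.2) 0) (I ×ˢ closure Ω) :=
    hw.sup continuousOn_const
  have hm : MeasurableSet (I ×ˢ Ω) := hI.measurableSet.prod hΩ
  have hfin : volume (I ×ˢ Ω) ≠ ⊤ := (hI.isBounded.prod hb).measure_lt_top.ne
  obtain ⟨B, hB⟩ := (hI.prod hb.isCompact_closure).exists_bound_of_continuousOn hq
  refine ((integrableOn_const hfin).sub hp).bdd_mul (c := B)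
    ((hq.mono (prod_mono subset_rfl subset_closure)).aestronglyMeasurable hm) ?_
  filter_upwards [ae_restrict_mem hm] with q hqI
    using hB q (prod_mono subset_rfl subset_closure hqI)

lemma SolvesOn.abs_le_infDist {z₀ : Space N → ℝ} (hz : SolvesOn Ω b f z₀ K T z)
    (hK : IsDistStable Ω K) : ∀ t ∈ Ioo 0 T, ∀ x ∈ Ω, |z t x| ≤ Metric.infDist x Ωᶜ := by
  obtain ⟨hzc, -, p, G, -, -, -, -, hvi⟩ := hz
  intro t ht x hx
  refine le_of_ae_restrict_le (μ := volume) isOpen_Ioo (f := fun t => |z t x|)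
    ((hzc.uncurry_right x (subset_closure hx)).mono Ioo_subset_Icc_self).abs
    continuousOn_const ?_ t ht
  filter_upwards [hvi, ae_restrict_mem measurableSet_Ioo] with τ hτK hτ
  exact hK.abs_le_infDist _ hτK.1
    ((hzc.uncurry_left τ (Ioo_subset_Icc_self hτ)).mono subset_closure) x hx

lemma SolvesOn.ae_infDist_le {z₀ : Space N → ℝ} (hz : SolvesOn Ω b f z₀ K T z)
    (hΩ : interior (closure Ω) = Ω) (hb : Bornology.IsBounded Ω) (hK : IsDistStable Ω K)
    {s t δ D : ℝ} (hs : s ∈ Ioo 0 T) (ht : t ∈ Ioo 0 T) (hst : s ≤ t)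
    (hD : ∀ x ∈ Ω, Metric.infDist x Ωᶜ ≤ D) (hδ : δ * (t - s) = 2 * D) (hδ0 : 0 ≤ δ)
    (hf : ∀ τ, s ≤ τ → ‖b‖ + δ ≤ f τ) :
    ∀ᵐ x ∂volume.restrict Ω, Metric.infDist x Ωᶜ ≤ z t x := by
  have hΩo : IsOpen Ω := hΩ ▸ isOpen_interior
  have hsub : Icc s t ⊆ Ioo 0 T := Icc_subset_Ioo hs.1 ht.2
  have habs := hz.abs_le_infDist hK s hs
  obtain ⟨hzc, -, p, G, hp2, hzp, hG, hzG, hvi⟩ := hz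
  have : IsFiniteMeasure (volume.restrict (cylinder Ω T)) :=
    isFiniteMeasure_restrict.2 (((Metric.isBounded_Ioo 0 T).prod hb).measure_lt_top.ne)
  have hp : IntegrableOn (fun q : ℝ × Space N => p q.1 q.2) (cylinder Ω T) :=
    hp2.integrable one_le_two
  let w : ℝ → Space N → ℝ := fun τ x => Metric.infDist x Ωᶜ - z τ x - (2 * D - δ * (τ - s))
  have hwc : ContinuousOn (fun q : ℝ × Space N => w q.1 q.2) (Icc s t ×ˢ closure Ω) := by
    refine ContinuousOn.sub (ContinuousOn.sub (Continuous.continuousOn ?_)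
      (hzc.mono (prod_mono_left (hsub.trans Ioo_subset_Icc_self)))) (by fun_prop)
    exact (Metric.continuous_infDist_pt _).comp continuous_snd
  have hwp := (integrable_posPart_mul_sub hΩo.measurableSet hb isCompact_Icc hwc
    (hp.mono_set (prod_mono_left hsub)) δ).mono_set (prod_mono_left Ioc_subset_Icc_self)
  rw [IntegrableOn, restrict_prod_eq] at hwp
  have hws : ∀ᵐ x ∂volume.restrict Ω, w s x ≤ 0 := by
    filter_upwards [ae_restrict_mem hΩo.measurableSet] with x hx
    simp only [w, sub_self, mul_zero, sub_zero]
    linarith [hD x hx, neg_le_of_abs_le (habs x hx)]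
  have hwle : ∀ᵐ τ ∂volume.restrict (Ioc s t),
      ∫ x in Ω, max (w τ x) 0 * (δ - p τ x) ≤ 0 := by
    filter_upwards [ae_restrict_of_ae_restrict_of_subset (Ioc_subset_Icc_self.trans hsub)
      (ae_setIntegral_posPart_mul_sub_nonpos hΩ hb hK hzc hp hG hzG hvi),
      ae_restrict_mem measurableSet_Ioc] with τ hτ hτst
    exact hτ _ δ (by nlinarith [hτst.2]) (hf τ hτst.1.le)
  filter_upwards [ae_nonpos_of_integral_posPart_mul_nonpos hst hwp
    (hzp.ae_infDist_sub_eq_add_integral (hs.1.trans hs.2) hΩo hb hzc hp hs ht hst (2 * D) δ)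
    hws hwle] with x hx
  simp only [hδ, sub_self, sub_zero] at hx
  exact sub_nonpos.1 hx

lemma SolvesOn.eqOn_bdist {z₀ : Space N → ℝ} (hz : SolvesOn Ω b f z₀ K T z)
    (hΩ : interior (closure Ω) = Ω) (hb : Bornology.IsBounded Ω) (hne : Ωᶜ.Nonempty)
    (hK : IsDistStable Ω K) {s t δ : ℝ} (hs : s ∈ Ioo 0 T) (ht : t ∈ Ioo 0 T) (hst : s ≤ t)
    (hδ : δ * (t - s) = 2 * maxBdist Ω) (hδ0 : 0 ≤ δ) (hf : ∀ τ, s ≤ τ → ‖b‖ + δ ≤ f τ) :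
    EqOn (z t) (bdist Ω) (closure Ω) := by
  have hΩo : IsOpen Ω := hΩ ▸ isOpen_interior
  have hd : EqOn (bdist Ω) (fun x => Metric.infDist x Ωᶜ) (closure Ω) :=
    fun x hx => bdist_eq_infDist_compl hΩo hne hx
  have hdD : ∀ x ∈ Ω, Metric.infDist x Ωᶜ ≤ maxBdist Ω := fun x hx =>
    (hd (subset_closure hx)).symm.trans_le (bdist_le_maxBdist hb (subset_closure hx))
  have hdc : Continuous fun x : Space N => Metric.infDist x Ωᶜ := Metric.continuous_infDist_pt _
  have hzt : ContinuousOn (z t) (closure Ω) := hz.1.uncurry_left t (Ioo_subset_Icc_self ht)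
  have hge := le_of_ae_restrict_le (μ := volume) hΩo hdc.continuousOn (hzt.mono subset_closure)
    (hz.ae_infDist_le hΩ hb hK hs ht hst hdD hδ hδ0 hf)
  have heq : EqOn (z t) (fun x => Metric.infDist x Ωᶜ) Ω := fun x hx =>
    (le_of_abs_le (hz.abs_le_infDist hK t ht x hx)).antisymm (hge x hx)
  exact (heq.of_subset_closure hzt hdc.continuousOn subset_closure subset_rfl).trans hd.symm

end Comparison

end Sandpile

theorem theorem4p3_general (N : ℕ) (hN : 1 ≤ N) (Ω : Set (Sandpile.Space N))
    (hΩ : interior (closure Ω) = Ω) (hΩ_bdd : Bornology.IsBounded Ω) (b : Sandpile.Space N)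
    (f : ℝ → ℝ) (hf : ((‖b‖ : ℝ) : EReal) < liminf (fun t : ℝ => ((f t : ℝ) : EReal)) atTop) :
    ∃ Tstar : ℝ, 0 ≤ Tstar ∧ ∀ (z₀ : Sandpile.Space N → ℝ) (z : ℝ → Sandpile.Space N → ℝ),
      (Sandpile.Solves Ω b f z₀ (Sandpile.gradientSet Ω) z ∨
        Sandpile.Solves Ω b f z₀ (Sandpile.obstacleSet Ω) z) →
      ∀ t : ℝ, Tstar ≤ t → ∀ x ∈ closure Ω, z t x = Sandpile.bdist Ω x := by
  have hΩo : IsOpen Ω := hΩ ▸ isOpen_interior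
  have hne : Ωᶜ.Nonempty := Sandpile.compl_nonempty_of_isBounded hN hΩ_bdd
  obtain ⟨r, hbr, hrf⟩ := EReal.lt_iff_exists_real_btwn.1 hf
  have hδ : 0 < r - ‖b‖ := sub_pos.2 (EReal.coe_lt_coe_iff.1 hbr)
  obtain ⟨T₀, hT₀⟩ := eventually_atTop.1 (eventually_lt_of_lt_liminf hrf)
  set τ := 2 * Sandpile.maxBdist Ω / (r - ‖b‖) with hτ
  have hτ0 : 0 ≤ τ := div_nonneg (mul_nonneg two_pos.le Sandpile.maxBdist_nonneg) hδ.le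
  refine ⟨max T₀ 1 + τ, by positivity, fun z₀ z hz t ht => ?_⟩
  have hs : max T₀ 1 ≤ t - τ := le_sub_iff_add_le.2 ht
  have hs0 : 0 < t - τ := zero_lt_one.trans_le ((le_max_right _ _).trans hs)
  have key : ∀ K, Sandpile.IsDistStable Ω K → Sandpile.Solves Ω b f z₀ K z →
      EqOn (z t) (Sandpile.bdist Ω) (closure Ω) := fun K hK hzK =>
    (hzK (t + 1) (by linarith)).eqOn_bdist hΩ hΩ_bdd hne hK ⟨hs0, by linarith⟩
      ⟨by linarith, lt_add_one t⟩ (sub_le_self t hτ0)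
      (by rw [sub_sub_cancel, hτ, mul_div_cancel₀ _ hδ.ne']) hδ.le fun σ hσ => by
        rw [add_sub_cancel]
        exact (EReal.coe_lt_coe_iff.1 (hT₀ σ (((le_max_left _ _).trans hs).trans hσ))).le
  rcases hz with hz | hz
  exacts [key _ (Sandpile.isDistStable_gradientSet hΩ hΩ_bdd hne) hz,
    key _ (Sandpile.isDistStable_obstacleSet hΩo hΩ_bdd hne) hz]

theorem theorem4p3 (N : ℕ) (hN : 1 ≤ N)
    (Ω : Set (Sandpile.Space N)) (hΩ_open : IsOpen Ω) (hΩ_bdd : Bornology.IsBounded Ω)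
    (hΩ_C2 : Sandpile.HasC2Boundary Ω)
    (b : Sandpile.Space N)
    (f : ℝ → ℝ) (hf_bdd : ∀ T : ℝ, 0 < T → MemLp f ⊤ (volume.restrict (Set.Ioo 0 T)))
    (z₀ : Sandpile.Space N → ℝ) (hz₀ : z₀ ∈ Sandpile.gradientSet Ω)
    (Dz₀ : Sandpile.Space N → Sandpile.Space N) (hDz₀ : Sandpile.HasH10Gradient Ω z₀ Dz₀)
    (h_init : ∀ t : ℝ, 0 < t → ∀ᵐ x ∂volume.restrict Ω,
      -Sandpile.bdist Ω x < z₀ x → inner ℝ b (Dz₀ x) ≤ f t)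
    (hf_mono : MonotoneOn f (Set.Ioi 0)) (hf_nonneg : ∀ t : ℝ, 0 < t → 0 ≤ f t)
    (hf_liminf : ((‖b‖ + 2 * Sandpile.maxBdist Ω : ℝ) : EReal) <
      Filter.liminf (fun t : ℝ => ((f t : ℝ) : EReal)) Filter.atTop) :
    ∃ Tstar : ℝ, 0 ≤ Tstar ∧ ∀ z : ℝ → Sandpile.Space N → ℝ,
      (Sandpile.Solves Ω b f z₀ (Sandpile.gradientSet Ω) z ∨
        Sandpile.Solves Ω b f z₀ (Sandpile.obstacleSet Ω) z) →
      ∀ t : ℝ, Tstar ≤ t → ∀ x ∈ closure Ω, z t x = Sandpile.bdist Ω x := by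
  have hb : ‖b‖ ≤ ‖b‖ + 2 * Sandpile.maxBdist Ω :=
    le_add_of_nonneg_right (mul_nonneg two_pos.le Sandpile.maxBdist_nonneg)
  obtain ⟨Tstar, hT, h⟩ := theorem4p3_general N hN Ω (hΩ_C2.interior_closure_eq hΩ_open) hΩ_bdd b f
    ((EReal.coe_le_coe_iff.2 hb).trans_lt hf_liminf)
  exact ⟨Tstar, hT, h z₀⟩
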